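/- A finite metric graph $G$ consists of finite sets $V$ of vertices and $E$ of edges, where each edge $e\in E$ has an initial vertex $o(e)$ and a terminal vertex $t(e)$ (loops and multiple edges are allowed) and is identified with an interval $[0,L(e)]$, $0<L(e)<\infty$. The degree of a vertex is the number of edge ends at it (a loop counts twice); a vertex is a boundary vertex if its degree is $1$ and an interior vertex if its degree is at least $2$. Let $L^2(G)=\bigoplus_{e\in E}L^2(0,L(e))$. The standard Laplacian $-\Delta_G$ acts in $L^2(G)$ as $f_e\mapsto -f_e''$ on every edge $e$; its domain consists of all $f=(f_e)_{e\in E}$ such that $f_e\in H^2(0,L(e))$ for every $e$, the boundary values of the $f_e$ at all edge ends at a common vertex coincide, and $\sum_{t(e)=v}f_e'(L(e))-\sum_{o(e)=v}f_e'(0)=0$ for every $v\in V$. For a graph with at least one edge, let $\lambda_1(G)\le\lambda_2(G)\le\cdots$ be the eigenvalues of $-\Delta_G$, counted with multiplicities. **Proposition.** Let $H$ be a finite, connected metric graph with at least one edge, and let $G$ be the graph which arises from $H$ by attaching finitely many pendant graphs to vertices of $H$; that is, for finitely many finite, connected metric graphs $P_i$, a vertex of $P_i$ is identified with a vertex of $H$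 (several $P_i$ may be attached to the same vertex of $H$). Then $$\lambda_k(G)\le\lambda_k(H)\qquad\text{for all } k=1,2,\dots.$$ If, in addition, $H$ is a path graph, i.e. a tree all of whose vertices have degree one or two, and at least one boundary vertex of $H$ is an interior vertex of $G$, then $\lambda_k(G)<\lambda_k(H)$ for all $k\ge 2$. -/

import Mathlib

open MeasureTheory Set

/-- A metric graph on the vertex set `V` with edge set `E`: every edge `e` runs from `o e` to `t e`
and is identified with the interval `[0, len e]`. Loops and multiple edges are allowed. -/
structure MetricGraph (V E : Type*) where
  o : E → V
  t : E → V
  len : E → ℝ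
  len_pos : ∀ e, 0 < len e

/-- The Hilbert space `L²(0, ℓ)` of complex-valued functions. -/
abbrev L2Interval (ℓ : ℝ) : Type := Lp ℂ 2 (volume.restrict (Ioo 0 ℓ))

/-- `g ∈ L²(0, ℓ)` is the weak derivative of `f ∈ L²(0, ℓ)`; thus `f` belongs to the Sobolev space
`H¹(0, ℓ)` and `f' = g`. -/
def HasWeakDeriv {ℓ : ℝ} (f g : L2Interval ℓ) : Prop :=
  ∀ φ : ℝ → ℝ, ContDiff ℝ (⊤ : ℕ∞) φ → HasCompactSupport φ → tsupport φ ⊆ Ioo 0 ℓ →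
    ∫ x in Ioo 0 ℓ, deriv φ x • f x = -∫ x in Ioo 0 ℓ, φ x • g x

/-- `f` has a representative that is continuous on `[0, ℓ]` and takes the value `c` at `x`.
Every element of `H¹(0, ℓ)` has exactly one continuous representative. -/
def HasEdgeValue {ℓ : ℝ} (f : L2Interval ℓ) (x : ℝ) (c : ℂ) : Prop :=
  ∃ u : ℝ → ℂ, ContinuousOn u (Icc 0 ℓ) ∧ (∀ᵐ y ∂volume.restrict (Ioo 0 ℓ), f y = u y) ∧ u x = c

namespace MetricGraph

variable {V E : Type*}

/-- Any two vertices are joined by a path, whose edges may be traversed in both directions. -/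
def IsConnected (G : MetricGraph V E) : Prop :=
  Nonempty V ∧ ∀ u v : V, Relation.EqvGen (fun a b => ∃ e, G.o e = a ∧ G.t e = b) u v

open scoped Classical in
/-- The degree of a vertex: the number of edge ends at `v`, so that a loop counts twice. -/
noncomputable def degree [Fintype E] (G : MetricGraph V E) (v : V) : ℕ :=
  (Finset.univ.filter fun e => G.o e = v).card + (Finset.univ.filter fun e => G.t e = v).card

def IsBoundaryVertex [Fintype E] (G : MetricGraph V E) (v : V) : Prop := G.degree v = 1

def IsInteriorVertex [Fintype E] (G : MetricGraph V E) (v : V) : Prop := 2 ≤ G.degree v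

/-- A finite graph is a tree if it is connected and `|V| = |E| + 1`. -/
def IsTree [Fintype V] [Fintype E] (G : MetricGraph V E) : Prop :=
  G.IsConnected ∧ Fintype.card V = Fintype.card E + 1

/-- A path graph is a tree all of whose vertices have degree one or two. -/
def IsPathGraph [Fintype V] [Fintype E] (G : MetricGraph V E) : Prop :=
  G.IsTree ∧ ∀ v, G.degree v = 1 ∨ G.degree v = 2

/-- The Hilbert space `L²(G)`, the orthogonal sum of the spaces `L²(0, len e)`. -/
abbrev L2 (G : MetricGraph V E) : Type _ := PiLp 2 fun e => L2Interval (G.len e)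

/-- `f` is continuous on `G` with the value `c v` at each vertex `v`: the limits of `f` along all
edge ends at a vertex coincide. -/
def HasVertexValues (G : MetricGraph V E) (f : G.L2) (c : V → ℂ) : Prop :=
  ∀ e, HasEdgeValue (f e) 0 (c (G.o e)) ∧ HasEdgeValue (f e) (G.len e) (c (G.t e))

open scoped Classical in
/-- The sum of the boundary values of the edgewise derivative `f'` at `v`, counted positively at
terminal ends and negatively at initial ends, vanishes at every vertex `v`. -/
def KirchhoffCondition [Fintype E] (G : MetricGraph V E) (f' : G.L2) : Prop :=
  ∃ a b : E → ℂ, (∀ e, HasEdgeValue (f' e) 0 (a e) ∧ HasEdgeValue (f' e) (G.len e) (b e)) ∧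
    ∀ v, (∑ e with G.t e = v, b e) - (∑ e with G.o e = v, a e) = 0

/-- `(f, h)` belongs to the graph of the standard Laplacian: `f` lies in `H²` of every edge, is
continuous on `G`, satisfies the Kirchhoff condition at every vertex, and `-f'' = h` on every
edge. -/
def IsStandardLaplacian [Fintype E] (G : MetricGraph V E) (f h : G.L2) : Prop :=
  ∃ f' : G.L2, (∀ e, HasWeakDeriv (f e) (f' e)) ∧ (∀ e, HasWeakDeriv (f' e) (-(h e))) ∧
    (∃ c : V → ℂ, G.HasVertexValues f c) ∧ G.KirchhoffCondition f'

/-- The span of all eigenfunctions of the standard Laplacian for eigenvalues `lam ≤ μ`. Its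
dimension is the number of eigenvalues in `(-∞, μ]`, counted with multiplicities. (The standard
Laplacian is selfadjoint, so there are no eigenvalues outside the real line.) -/
noncomputable def spectralSubspace [Fintype E] (G : MetricGraph V E) (μ : ℝ) :
    Submodule ℂ G.L2 :=
  Submodule.span ℂ {f | ∃ lam : ℝ, lam ≤ μ ∧ G.IsStandardLaplacian f ((lam : ℂ) • f)}

/-- The `k`-th eigenvalue of the standard Laplacian, `k = 1, 2, …`, in nondecreasing order and
counted with multiplicities: the least `μ` such that there are at least `k` eigenvalues in
`(-∞, μ]`. -/
noncomputable def eigenvalue [Fintype E] (G : MetricGraph V E) (k : ℕ) : ℝ :=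
  sInf {μ : ℝ | (k : Cardinal) ≤ Module.rank ℂ (G.spectralSubspace μ)}

section Attach

variable {ι : Type*} {W F : ι → Type*}

open scoped Classical in
/-- The vertex of the glued graph given by the vertex `w` of the `i`-th pendant graph: the root
`r i` is identified with the vertex `a i` of the base graph. -/
noncomputable def pendantVertex (r : ∀ i, W i) (a : ι → V) (i : ι) (w : W i) :
    V ⊕ (Σ i, {w : W i // w ≠ r i}) :=
  if h : w = r i then Sum.inl (a i) else Sum.inr ⟨i, w, h⟩

/-- The graph that arises from `H` by attaching, for every `i`, the graph `P i` to the vertex `a i`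
of `H`, by identifying the vertex `r i` of `P i` with `a i`. Several graphs may be attached to the
same vertex. -/
noncomputable def attach (H : MetricGraph V E) (P : ∀ i, MetricGraph (W i) (F i))
    (r : ∀ i, W i) (a : ι → V) :
    MetricGraph (V ⊕ (Σ i, {w : W i // w ≠ r i})) (E ⊕ (Σ i, F i)) where
  o := Sum.elim (fun e => Sum.inl (H.o e)) (fun e => pendantVertex r a e.1 ((P e.1).o e.2))
  t := Sum.elim (fun e => Sum.inl (H.t e)) (fun e => pendantVertex r a e.1 ((P e.1).t e.2))
  len := Sum.elim H.len (fun e => (P e.1).len e.2)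
  len_pos := by
    rintro (e | ⟨i, e⟩)
    · exact H.len_pos e
    · exact (P i).len_pos e

end Attach

end MetricGraph

/-! A function in H¹(H) extends to G by giving it, on each pendant graph, the constant value at the
attaching vertex (`extend`). The energy ‖f'‖² is unchanged and ‖f‖² does not decrease
(`norm_sq_derivL2_extend`, `norm_sq_toL2_extend`). Hence Rayleigh quotients on the span of k
eigenfunctions of H stay below λ_k(H) ≥ 0, and the min-max principle gives the inequality.

For strictness, suppose that the largest quotient on the extended space is at least λ_k(H), and let
f ≠ 0 attain it. Since λ_k(H) > 0 for k ≥ 2, f gains no mass, so it vanishes where a pendant edge is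
attached, in particular at a boundary vertex v. It also has quotient λ_k(H) on H, hence is an
eigenfunction (`mem_eigenspace_of_norm_sq_eq`). Kirchhoff at v gives f' = 0 there too, and zero
Cauchy data propagate through vertices of degree at most two. So f = 0
(`IsConnected.eq_zero_of_boundary_value_eq_zero`), a contradiction.

The analysis rests on writing an H¹ function on an edge as a constant plus a primitive
(`HasWeakDeriv.exists_eq`). H¹(G) becomes a closed space of pairs of vertex values and edgewise
derivatives, and operator eigenfunctions are the weak ones (`spectralSubspace_eq_map`). Min-max is
proved for abstract pairs `J`, `D` with `J` compact and the pair coercive; its core is the spectral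
gap `exists_gap`. -/

open scoped InnerProductSpace ComplexConjugate ContDiff Topology

/-! ### Primitives on an interval and integration by parts. -/

namespace L2Interval

variable {ℓ : ℝ}

/-- The constant function `1` in `L²(0, ℓ)`. -/
noncomputable def one (ℓ : ℝ) : L2Interval ℓ := Lp.const 2 (volume.restrict (Ioo 0 ℓ)) (1 : ℂ)

theorem coeFn_one : (one ℓ : ℝ → ℂ) =ᵐ[volume.restrict (Ioo 0 ℓ)] fun _ => 1 :=
  Lp.coeFn_const _ _ _

theorem coeFn_smul_one (c : ℂ) :
    (c • one ℓ : L2Interval ℓ) =ᵐ[volume.restrict (Ioo 0 ℓ)] fun _ => c := by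
  filter_upwards [Lp.coeFn_smul c (one ℓ), coeFn_one (ℓ := ℓ)] with x h1 h2
  simp [h1, h2]

theorem integrable (g : L2Interval ℓ) : Integrable g (volume.restrict (Ioo 0 ℓ)) :=
  (Lp.memLp g).integrable one_le_two

/-- The integral over `(0, ℓ)`, as a functional on `L²(0, ℓ)`. -/
noncomputable def total (ℓ : ℝ) : L2Interval ℓ →L[ℂ] ℂ := innerSL ℂ (one ℓ)

theorem total_eq_inner (g : L2Interval ℓ) : total ℓ g = ⟪one ℓ, g⟫_ℂ := rfl

theorem inner_one_right (g : L2Interval ℓ) : ⟪g, one ℓ⟫_ℂ = conj (total ℓ g) :=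
  (inner_conj_symm _ _).symm

theorem total_eq_integral (g : L2Interval ℓ) : total ℓ g = ∫ x in Ioo 0 ℓ, g x := by
  rw [total_eq_inner, L2.inner_def]
  refine integral_congr_ae ?_
  filter_upwards [coeFn_one (ℓ := ℓ)] with x hx
  simp [hx]

/-- The primitive of `g` that vanishes at `0`, defined on all of `ℝ`. -/
noncomputable def prim (g : L2Interval ℓ) (x : ℝ) : ℂ :=
  ∫ t in Iic x, g t ∂volume.restrict (Ioo 0 ℓ)

/-- Written as an inner product, the increment is open to Cauchy–Schwarz, which yields the
Hölder-1/2 bound behind continuity and compactness. -/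
theorem prim_sub_eq_inner (g : L2Interval ℓ) {x y : ℝ} (hxy : x ≤ y) :
    prim g y - prim g x = ⟪indicatorConstLp 2 (measurableSet_Ioc (a := x) (b := y))
      (measure_ne_top (volume.restrict (Ioo 0 ℓ)) _) (1 : ℂ), g⟫_ℂ := by
  rw [L2.inner_indicatorConstLp_one, prim, prim, ← Iic_union_Ioc_eq_Iic hxy,
    setIntegral_union (Iic_disjoint_Ioc le_rfl) measurableSet_Ioc
      (integrable g).integrableOn (integrable g).integrableOn]
  simp

theorem norm_prim_sub_le (g : L2Interval ℓ) {x y : ℝ} (hxy : x ≤ y) :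
    ‖prim g y - prim g x‖ ≤ √(y - x) * ‖g‖ := by
  rw [prim_sub_eq_inner g hxy]
  refine (norm_inner_le_norm _ _).trans ?_
  gcongr
  rw [norm_indicatorConstLp (by simp) (by simp)]
  simp only [norm_one, one_mul, ENNReal.toReal_ofNat]
  rw [← Real.sqrt_eq_rpow]
  refine Real.sqrt_le_sqrt ?_
  have h : (volume.restrict (Ioo 0 ℓ)) (Ioc x y) ≤ ENNReal.ofReal (y - x) := by
    simpa using Measure.restrict_apply_le (μ := volume) (Ioo 0 ℓ) (Ioc x y)
  simpa [Measure.real, sub_nonneg.2 hxy] using ENNReal.toReal_mono (by simp) h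

theorem continuous_prim (g : L2Interval ℓ) : Continuous (prim g) := by
  have key : ∀ x y, ‖prim g y - prim g x‖ ≤ √|y - x| * ‖g‖ := by
    intro x y
    rcases le_total x y with h | h
    · simpa [abs_of_nonneg (sub_nonneg.2 h)] using norm_prim_sub_le g h
    · rw [norm_sub_rev, abs_sub_comm]
      simpa [abs_of_nonneg (sub_nonneg.2 h)] using norm_prim_sub_le g h
  rw [continuous_iff_continuousAt]
  intro x
  rw [ContinuousAt, tendsto_iff_norm_sub_tendsto_zero]
  refine squeeze_zero (fun _ => norm_nonneg _) (fun y => key x y) ?_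
  have : Continuous fun y => √|y - x| * ‖g‖ := by fun_prop
  simpa using this.tendsto x

theorem prim_of_nonpos (g : L2Interval ℓ) {x : ℝ} (hx : x ≤ 0) : prim g x = 0 := by
  rw [prim, Measure.restrict_restrict measurableSet_Iic]
  have : Iic x ∩ Ioo 0 ℓ = ∅ := by
    ext t; simp only [mem_inter_iff, mem_Iic, mem_Ioo, mem_empty_iff_false, iff_false]
    rintro ⟨h1, h2, -⟩; linarith
  simp [this]

theorem prim_zero (g : L2Interval ℓ) : prim g 0 = 0 := prim_of_nonpos g le_rfl

theorem prim_end (g : L2Interval ℓ) : prim g ℓ = total ℓ g := by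
  rw [prim, Measure.restrict_restrict measurableSet_Iic, total_eq_integral,
    inter_eq_self_of_subset_right]
  exact fun t ht => ht.2.le

theorem prim_congr {u : ℝ → ℂ} (g : L2Interval ℓ)
    (hu : g =ᵐ[volume.restrict (Ioo 0 ℓ)] u) (x : ℝ) :
    prim g x = ∫ t in Iic x, u t ∂volume.restrict (Ioo 0 ℓ) :=
  integral_congr_ae (ae_restrict_of_ae hu)

theorem prim_eq_intervalIntegral (g : L2Interval ℓ) {u : ℝ → ℂ}
    (hu : g =ᵐ[volume.restrict (Ioo 0 ℓ)] u) {x : ℝ} (h0 : 0 ≤ x) (hx : x ≤ ℓ) :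
    prim g x = ∫ t in 0..x, u t := by
  have h : (Iic x ∩ Ioo 0 ℓ : Set ℝ) =ᵐ[volume] Ioc 0 x := by
    have h1 : (Iic x ∩ Ioo 0 ℓ : Set ℝ) =ᵐ[volume] (Iio x ∩ Ioo 0 ℓ : Set ℝ) :=
      Iio_ae_eq_Iic.symm.inter (Filter.EventuallyEq.refl _ _)
    have h2 : Iio x ∩ Ioo 0 ℓ = Ioo 0 x := by
      ext t; simp only [mem_inter_iff, mem_Iio, mem_Ioo]
      constructor
      · rintro ⟨h1, h2, -⟩; exact ⟨h2, h1⟩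
      · rintro ⟨h1, h2⟩; exact ⟨h2, h1, h2.trans_le hx⟩
    rw [h2] at h1
    exact h1.trans Ioo_ae_eq_Ioc
  rw [prim_congr g hu, intervalIntegral.integral_of_le h0,
    Measure.restrict_restrict measurableSet_Iic, Measure.restrict_congr_set h]

theorem norm_prim_le (g : L2Interval ℓ) {x : ℝ} (h0 : 0 ≤ x) : ‖prim g x‖ ≤ √x * ‖g‖ := by
  simpa [prim_zero] using norm_prim_sub_le g h0

theorem memLp_prim (g : L2Interval ℓ) : MemLp (prim g) 2 (volume.restrict (Ioo 0 ℓ)) := by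
  refine MemLp.of_bound (continuous_prim g).aestronglyMeasurable (√ℓ * ‖g‖) ?_
  filter_upwards [ae_restrict_mem measurableSet_Ioo] with x hx
  refine (norm_prim_le g hx.1.le).trans ?_
  gcongr
  exact hx.2.le

theorem prim_add (g h : L2Interval ℓ) (x : ℝ) : prim (g + h) x = prim g x + prim h x := by
  rw [prim_congr _ (Lp.coeFn_add g h)]
  exact integral_add (integrable g).integrableOn (integrable h).integrableOn

theorem prim_smul (c : ℂ) (g : L2Interval ℓ) (x : ℝ) : prim (c • g) x = c * prim g x := by
  rw [prim_congr _ (Lp.coeFn_smul c g)]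
  exact integral_const_mul c _

theorem measure_Ioo_rpow : ((volume.restrict (Ioo 0 ℓ)) univ).toReal ^ (1 / (2:ℝ)) = √ℓ := by
  rw [← Real.sqrt_eq_rpow]
  by_cases h : 0 ≤ ℓ
  · simp [h]
  · simp [Real.sqrt_eq_zero_of_nonpos (not_le.1 h).le, ENNReal.ofReal_of_nonpos (not_le.1 h).le]

theorem norm_le_of_ae_bound (g : L2Interval ℓ) {C : ℝ} (hC : 0 ≤ C)
    (h : ∀ᵐ x ∂volume.restrict (Ioo 0 ℓ), ‖g x‖ ≤ C) : ‖g‖ ≤ √ℓ * C := by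
  have := Lp.norm_le_of_ae_bound hC h
  rw [← measure_Ioo_rpow, one_div]
  exact this

/-- The Volterra operator `g ↦ ∫₀ˣ g` on `L²(0, ℓ)`. -/
noncomputable def volterra (ℓ : ℝ) : L2Interval ℓ →L[ℂ] L2Interval ℓ :=
  LinearMap.mkContinuous
    { toFun := fun g => (memLp_prim g).toLp (prim g)
      map_add' := fun g h => by
        rw [← MemLp.toLp_add]
        congr 1
        ext x; exact prim_add g h x
      map_smul' := fun c g => by
        rw [RingHom.id_apply, ← MemLp.toLp_const_smul]
        congr 1
        ext x; exact prim_smul c g x }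
    (√ℓ * √ℓ) (fun g => by
      rw [mul_assoc]
      refine norm_le_of_ae_bound _ (by positivity) ?_
      filter_upwards [MemLp.coeFn_toLp (memLp_prim g), ae_restrict_mem measurableSet_Ioo]
        with x h1 hx
      simp only [LinearMap.coe_mk, AddHom.coe_mk, h1]
      refine (norm_prim_le g hx.1.le).trans ?_
      gcongr
      exact hx.2.le)

theorem coeFn_volterra (g : L2Interval ℓ) :
    volterra ℓ g =ᵐ[volume.restrict (Ioo 0 ℓ)] prim g :=
  MemLp.coeFn_toLp (memLp_prim g)

theorem coeFn_smul_one_add_volterra (c : ℂ) (g : L2Interval ℓ) :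
    (c • one ℓ + volterra ℓ g : L2Interval ℓ) =ᵐ[volume.restrict (Ioo 0 ℓ)]
      fun x => c + prim g x := by
  filter_upwards [Lp.coeFn_add (c • one ℓ) (volterra ℓ g), coeFn_smul_one (ℓ := ℓ) c,
    coeFn_volterra g] with x h1 h2 h3
  rw [h1, Pi.add_apply, h2, h3]

theorem hasEdgeValue_smul_one_add_volterra_zero (c : ℂ) (g : L2Interval ℓ) :
    HasEdgeValue (c • one ℓ + volterra ℓ g) 0 c :=
  ⟨fun x => c + prim g x, (continuous_const.add (continuous_prim g)).continuousOn,
    coeFn_smul_one_add_volterra c g, by simp [prim_zero]⟩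

theorem hasEdgeValue_smul_one_add_volterra_end (c : ℂ) (g : L2Interval ℓ) :
    HasEdgeValue (c • one ℓ + volterra ℓ g) ℓ (c + total ℓ g) :=
  ⟨fun x => c + prim g x, (continuous_const.add (continuous_prim g)).continuousOn,
    coeFn_smul_one_add_volterra c g, by simp [prim_end]⟩

/-- Continuous functions that agree almost everywhere on an interval of positive length agree on its
closure, endpoints included. -/
theorem _root_.HasEdgeValue.unique {f : L2Interval ℓ} {x : ℝ} (hx : x ∈ Icc 0 ℓ) (hℓ : 0 < ℓ)
    {c d : ℂ} (hc : HasEdgeValue f x c) (hd : HasEdgeValue f x d) : c = d := by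
  obtain ⟨u, hu, hfu, rfl⟩ := hc
  obtain ⟨v, hv, hfv, rfl⟩ := hd
  refine Measure.eqOn_Icc_of_ae_eq volume hℓ.ne ?_ hu hv hx
  rw [← Measure.restrict_congr_set (Ioo_ae_eq_Icc (μ := volume))]
  filter_upwards [hfu, hfv] with y h1 h2
  rw [← h1, h2]

/-- Integration by parts for primitives. -/
theorem inner_volterra_add (p q : L2Interval ℓ) :
    ⟪volterra ℓ p, q⟫_ℂ + ⟪p, volterra ℓ q⟫_ℂ = conj (total ℓ p) * total ℓ q := by
  set μ := volume.restrict (Ioo 0 ℓ) with hμ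
  -- By Fubini the two inner products are the integrals of `F` over the complementary triangles s ≤
  -- t and t < s, so their sum is a product of integrals.
  let F : ℝ × ℝ → ℂ := fun z => conj (p z.1) * q z.2
  have hp : Integrable (fun x => conj (p x)) μ :=
    (integrable p).congr' ((Lp.aestronglyMeasurable p).star) (by simp)
  have hF : Integrable F (μ.prod μ) := hp.mul_prod (integrable q)
  let T : Set (ℝ × ℝ) := {z | z.1 ≤ z.2}
  have hT : MeasurableSet T := measurableSet_le measurable_fst measurable_snd
  have h1 : ⟪volterra ℓ p, q⟫_ℂ = ∫ z in T, F z ∂(μ.prod μ) := by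
    rw [← integral_indicator hT, integral_prod_symm _ (hF.indicator hT), L2.inner_def]
    refine integral_congr_ae ?_
    filter_upwards [coeFn_volterra p] with x hx
    rw [RCLike.inner_apply, hx, prim, ← integral_conj, mul_comm, ← integral_mul_const,
      ← integral_indicator measurableSet_Iic]
    rfl
  have h2 : ⟪p, volterra ℓ q⟫_ℂ = ∫ z in Tᶜ, F z ∂(μ.prod μ) := by
    rw [← integral_indicator hT.compl, integral_prod _ (hF.indicator hT.compl), L2.inner_def]
    refine integral_congr_ae ?_
    filter_upwards [coeFn_volterra q] with x hx
    rw [RCLike.inner_apply, hx, prim, integral_Iic_eq_integral_Iio, mul_comm,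
      ← integral_const_mul,      ← integral_indicator measurableSet_Iio]
    congr 1 with t
    simp [indicator, T, F]
  rw [h1, h2, integral_add_compl hT hF, integral_prod_mul (fun x => conj (p x)), integral_conj, total_eq_integral,
    total_eq_integral]

/-- Integration by parts for two `H¹` functions. -/
theorem inner_add_inner_eq (a b : ℂ) (p q : L2Interval ℓ) :
    ⟪q, a • one ℓ + volterra ℓ p⟫_ℂ + ⟪b • one ℓ + volterra ℓ q, p⟫_ℂ =
      conj (b + total ℓ q) * (a + total ℓ p) - conj b * a := by
  have h := inner_volterra_add q p
  simp only [inner_add_right, inner_add_left, inner_smul_left, inner_smul_right, inner_one_right,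
    ← total_eq_inner, map_add]
  linear_combination h

end L2Interval

/-! ### Weak derivatives, the initial value problem, and compactness. -/

namespace L2Interval

variable {ℓ : ℝ}

theorem memLp_of_continuous {u : ℝ → ℂ} (hu : Continuous u) :
    MemLp u 2 (volume.restrict (Ioo 0 ℓ)) := by
  obtain ⟨C, hC⟩ := isCompact_Icc.exists_bound_of_continuousOn (s := Icc 0 ℓ) hu.continuousOn
  refine MemLp.of_bound hu.aestronglyMeasurable C ?_
  filter_upwards [ae_restrict_mem measurableSet_Ioo] with x hx
  exact hC x ⟨hx.1.le, hx.2.le⟩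

/-- The element of `L²(0, ℓ)` given by a continuous function on `ℝ`. -/
noncomputable def ofCont (ℓ : ℝ) (u : ℝ → ℂ) (hu : Continuous u) : L2Interval ℓ :=
  (memLp_of_continuous hu).toLp u

theorem coeFn_ofCont {u : ℝ → ℂ} (hu : Continuous u) :
    ofCont ℓ u hu =ᵐ[volume.restrict (Ioo 0 ℓ)] u :=
  MemLp.coeFn_toLp _

theorem inner_ofCont_ofReal {φ : ℝ → ℝ} (hφ : Continuous fun x => (φ x : ℂ)) (f : L2Interval ℓ) :
    ⟪ofCont ℓ _ hφ, f⟫_ℂ = ∫ x in Ioo 0 ℓ, φ x • f x := by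
  rw [L2.inner_def]
  refine integral_congr_ae ?_
  filter_upwards [coeFn_ofCont (ℓ := ℓ) hφ] with x hx
  rw [RCLike.inner_apply, hx, Complex.conj_ofReal, Complex.real_smul, mul_comm]

theorem prim_ofCont {u u' : ℝ → ℂ} (hu' : Continuous u') (h : ∀ x, HasDerivAt u (u' x) x)
    {x : ℝ} (h0 : 0 ≤ x) (hx : x ≤ ℓ) : prim (ofCont ℓ u' hu') x = u x - u 0 := by
  rw [prim_eq_intervalIntegral _ (coeFn_ofCont hu') h0 hx]
  exact intervalIntegral.integral_eq_sub_of_hasDerivAt (fun y _ => h y)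
    (hu'.intervalIntegrable _ _)

theorem total_ofCont {u u' : ℝ → ℂ} (hu' : Continuous u') (h : ∀ x, HasDerivAt u (u' x) x)
    (hℓ : 0 ≤ ℓ) : total ℓ (ofCont ℓ u' hu') = u ℓ - u 0 := by
  rw [← prim_end, prim_ofCont hu' h hℓ le_rfl]

theorem volterra_ofCont {u u' : ℝ → ℂ} (hu : Continuous u) (hu' : Continuous u')
    (h : ∀ x, HasDerivAt u (u' x) x) (h0 : u 0 = 0) :
    volterra ℓ (ofCont ℓ u' hu') = ofCont ℓ u hu := by
  refine Lp.ext ?_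
  filter_upwards [coeFn_volterra (ofCont ℓ u' hu'), coeFn_ofCont (ℓ := ℓ) hu,
    ae_restrict_mem measurableSet_Ioo] with x h1 h2 hx
  rw [h1, h2, prim_ofCont hu' h hx.1.le hx.2.le, h0, sub_zero]

/-- For a test function `φ` on `(0, ℓ)`, integration by parts against a primitive. -/
theorem inner_test_volterra (hℓ : 0 < ℓ) {φ : ℝ → ℝ} (hφ : ContDiff ℝ ∞ φ)
    (hs : tsupport φ ⊆ Ioo 0 ℓ) (hc : Continuous fun x => (φ x : ℂ))
    (hc' : Continuous fun x => ((deriv φ x : ℝ) : ℂ)) (a : ℂ) (g : L2Interval ℓ) :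
    ⟪ofCont ℓ _ hc', a • one ℓ + volterra ℓ g⟫_ℂ = -⟪ofCont ℓ _ hc, g⟫_ℂ := by
  have hd : ∀ x, HasDerivAt (fun x => (φ x : ℂ)) ((deriv φ x : ℝ) : ℂ) x := fun x =>
    ((hφ.differentiable (by simp)).differentiableAt.hasDerivAt).ofReal_comp
  have h0 : φ 0 = 0 := image_eq_zero_of_notMem_tsupport fun h => lt_irrefl _ (hs h).1
  have h1 : φ ℓ = 0 := image_eq_zero_of_notMem_tsupport fun h => lt_irrefl _ (hs h).2
  have hI := volterra_ofCont (ℓ := ℓ) hc hc' hd (by simp [h0])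
  have hT := total_ofCont (ℓ := ℓ) hc' hd hℓ.le
  have := inner_add_inner_eq a 0 g (ofCont ℓ _ hc')
  rw [hI, hT] at this
  simp only [h0, h1, zero_smul, zero_add] at this
  linear_combination this + (by simp : conj (((0 : ℝ) : ℂ) - ((0 : ℝ) : ℂ)) * (a + total ℓ g) -
    conj 0 * a = 0)

theorem hasWeakDeriv_smul_one_add_volterra (hℓ : 0 < ℓ) (a : ℂ) (g : L2Interval ℓ) :
    HasWeakDeriv (a • one ℓ + volterra ℓ g) g := by
  intro φ hφ _ hs
  have hc : Continuous fun x => (φ x : ℂ) := by have := hφ.continuous; fun_prop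
  have hc' : Continuous fun x => ((deriv φ x : ℝ) : ℂ) := by
    have := hφ.continuous_deriv (by simp); fun_prop
  rw [← inner_ofCont_ofReal hc', ← inner_ofCont_ofReal hc]
  exact inner_test_volterra hℓ hφ hs hc hc' a g

/-- A test function with vanishing integral is the derivative of a test function. -/
theorem exists_test_primitive {θ : ℝ → ℝ} (hθ : ContDiff ℝ ∞ θ) (hc : HasCompactSupport θ)
    (hs : tsupport θ ⊆ Ioo 0 ℓ) (hi : ∫ x, θ x = 0) :
    ∃ φ : ℝ → ℝ, ContDiff ℝ ∞ φ ∧ HasCompactSupport φ ∧ tsupport φ ⊆ Ioo 0 ℓ ∧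
      deriv φ = θ := by
  rcases (tsupport θ).eq_empty_or_nonempty with he | hne
  · rw [tsupport_eq_empty_iff] at he
    refine ⟨0, contDiff_const, HasCompactSupport.zero, ?_, ?_⟩
    · simp [tsupport_eq_empty_iff.2]
    · rw [he]; ext x; simp
  obtain ⟨a, ha, ha'⟩ := hc.isCompact.exists_isLeast hne
  obtain ⟨b, hb, hb'⟩ := hc.isCompact.exists_isGreatest hne
  have hθ0 : ∀ x, x ∉ Icc a b → θ x = 0 := fun x hx =>
    image_eq_zero_of_notMem_tsupport fun h => hx ⟨ha' h, hb' h⟩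
  have hd : ∀ x, HasDerivAt (fun x => ∫ t in 0..x, θ t) (θ x) x := fun x =>
    (intervalIntegral.integral_hasDerivAt_right (hθ.continuous.intervalIntegrable _ _)
      hθ.continuous.aestronglyMeasurable.stronglyMeasurableAtFilter hθ.continuous.continuousAt)
  have hderiv : deriv (fun x => ∫ t in 0..x, θ t) = θ := funext fun x => (hd x).deriv
  -- To the left of the support the integrand vanishes on the whole interval of integration; to the
  -- right the integral is the full one, which is zero.
  have hsupp : ∀ x, x ∉ Icc a b → ∫ t in 0..x, θ t = 0 := by
    intro x hx
    rw [mem_Icc, not_and_or, not_le, not_le] at hx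
    rcases hx with hx | hx
    · rw [intervalIntegral.integral_congr (g := fun _ => 0), intervalIntegral.integral_zero]
      intro t ht
      refine hθ0 t fun h => ?_
      have := ht.2.trans_lt (max_lt (hs ha).1 hx)
      exact absurd h.1 (not_le.2 this)
    · rw [intervalIntegral.integral_eq_integral_of_support_subset, hi]
      intro t ht
      have : t ∈ Icc a b := by
        by_contra h
        exact ht (hθ0 t h)
      exact ⟨(hs ha).1.trans_le this.1, this.2.trans hx.le⟩
  have htsupp : tsupport (fun x => ∫ t in 0..x, θ t) ⊆ Icc a b :=
    closure_minimal (fun x hx => by_contra fun h => hx (hsupp x h)) isClosed_Icc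
  refine ⟨fun x => ∫ t in 0..x, θ t, ?_, ?_, ?_, hderiv⟩
  · rw [contDiff_infty_iff_deriv, hderiv]
    exact ⟨fun x => (hd x).differentiableAt, hθ⟩
  · exact isCompact_Icc.of_isClosed_subset (isClosed_tsupport _) htsupp
  · exact htsupp.trans fun x hx => ⟨(hs ha).1.trans_le hx.1, hx.2.trans_lt (hs hb).2⟩

/-- The lemma of du Bois-Reymond: a function in `L²(0, ℓ)` that annihilates the derivatives of all
test functions is constant. -/
theorem exists_eq_smul_one (hℓ : 0 < ℓ) (k : L2Interval ℓ)
    (hk : ∀ φ : ℝ → ℝ, ContDiff ℝ ∞ φ → HasCompactSupport φ → tsupport φ ⊆ Ioo 0 ℓ →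
      ∫ x in Ioo 0 ℓ, deriv φ x • k x = 0) : ∃ a : ℂ, k = a • one ℓ := by
  -- A bump around the midpoint, supported in [ℓ/4, 3ℓ/4]; its normalisation `ψ` has integral 1, so
  -- the constant sought can only be ∫ ψ k.
  let B : ContDiffBump (ℓ / 2) := ⟨ℓ / 8, ℓ / 4, by linarith, by linarith⟩
  let ψ := B.normed volume
  have hψ : ContDiff ℝ ∞ ψ := B.contDiff_normed
  have hψc : HasCompactSupport ψ := B.hasCompactSupport_normed
  have hψs : tsupport ψ ⊆ Ioo 0 ℓ := by
    rw [B.tsupport_normed_eq, Real.closedBall_eq_Icc]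
    intro x hx
    have h1 : B.rOut = ℓ / 4 := rfl
    rw [h1] at hx
    constructor <;> linarith [hx.1, hx.2]
  let a : ℂ := ∫ x in Ioo 0 ℓ, ψ x • k x
  have hint : ∀ η : ℝ → ℝ, Continuous η →
      Integrable (fun x => η x • k x) (volume.restrict (Ioo 0 ℓ)) := by
    intro η hη
    have hc : Continuous fun x => (η x : ℂ) := by fun_prop
    refine (L2.integrable_inner (𝕜 := ℂ) (ofCont ℓ _ hc) k).congr ?_
    filter_upwards [coeFn_ofCont (ℓ := ℓ) hc] with x hx
    rw [RCLike.inner_apply, hx, Complex.conj_ofReal, Complex.real_smul, mul_comm]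
  have hint' : ∀ η : ℝ → ℝ, Continuous η →
      Integrable (fun x => η x • a) (volume.restrict (Ioo 0 ℓ)) := fun η hη =>
    ((hη.integrableOn_Icc (a := 0) (b := ℓ)).mono_set Ioo_subset_Icc_self).smul_const a
  refine ⟨a, Lp.ext ?_⟩
  have key : ∀ᵐ x, x ∈ Ioo 0 ℓ → k x - a = 0 := by
    refine isOpen_Ioo.ae_eq_zero_of_integral_contDiff_smul_eq_zero ?_ ?_
    · refine IntegrableOn.locallyIntegrableOn ?_
      exact (integrable k).sub (integrable_const a)
    intro η hη hηc hηs
    have hηsupp : ∀ x ∉ Ioo 0 ℓ, η x • (k x - a) = 0 := fun x hx => by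
      rw [image_eq_zero_of_notMem_tsupport fun h => hx (hηs h), zero_smul]
    rw [← setIntegral_eq_integral_of_forall_compl_eq_zero hηsupp]
    -- Subtracting (∫ η) ψ makes the integral of `η` vanish, so the difference is the derivative of
    -- a test function.
    obtain ⟨φ, h1, h2, h3, h4⟩ := exists_test_primitive (ℓ := ℓ) (θ := fun x => η x - (∫ y, η y) * ψ x)
      (hη.sub (contDiff_const.mul hψ)) (hηc.sub hψc.mul_left)
      ((tsupport_sub _ _).trans (union_subset hηs ((tsupport_mul_subset_right).trans hψs))) (by
        rw [integral_sub (hη.continuous.integrable_of_hasCompactSupport hηc)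
          ((hψ.continuous.integrable_of_hasCompactSupport hψc).const_mul _), integral_const_mul,
          B.integral_normed, mul_one, sub_self])
    have := hk φ h1 h2 h3
    rw [h4] at this
    simp only [sub_smul, mul_smul] at this
    have hi2 : Integrable (fun x => (∫ y, η y) • ψ x • k x) (volume.restrict (Ioo 0 ℓ)) :=
      (hint ψ hψ.continuous).fun_smul (∫ y, η y)
    rw [integral_sub (hint η hη.continuous) hi2,
      integral_smul] at this
    simp only [smul_sub]
    rw [integral_sub (hint η hη.continuous) (hint' η hη.continuous), integral_smul_const,
      setIntegral_eq_integral_of_forall_compl_eq_zero (f := η)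
        (fun x hx => image_eq_zero_of_notMem_tsupport fun h => hx (hηs h))]
    exact this
  filter_upwards [ae_restrict_mem measurableSet_Ioo, ae_restrict_of_ae key,
    coeFn_smul_one (ℓ := ℓ) a] with x hx h1 h2
  rw [h2]
  exact sub_eq_zero.1 (h1 hx)

/-- f minus the primitive of g has weak derivative zero, so du Bois-Reymond applies. Every Sobolev
function on an edge is thus coded by a constant and its derivative. -/
theorem _root_.HasWeakDeriv.exists_eq (hℓ : 0 < ℓ) {f g : L2Interval ℓ} (h : HasWeakDeriv f g) :
    ∃ a : ℂ, f = a • one ℓ + volterra ℓ g := by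
  obtain ⟨a, ha⟩ := exists_eq_smul_one hℓ (f - volterra ℓ g) fun φ hφ hφc hs => by
    have hc : Continuous fun x => (φ x : ℂ) := by have := hφ.continuous; fun_prop
    have hc' : Continuous fun x => ((deriv φ x : ℝ) : ℂ) := by
      have := hφ.continuous_deriv (by simp); fun_prop
    have h1 := h φ hφ hφc hs
    have h2 := inner_test_volterra hℓ hφ hs hc hc' 0 g
    rw [← inner_ofCont_ofReal hc', ← inner_ofCont_ofReal hc] at h1
    rw [zero_smul, zero_add] at h2
    rw [← inner_ofCont_ofReal hc', inner_sub_right, h1, h2, sub_self]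
  exact ⟨a, by rw [← ha, sub_add_cancel]⟩

/-- The Volterra operator is injective, even modulo constants. -/
theorem eq_zero_of_smul_one_add_volterra_eq_zero (hℓ : 0 < ℓ) {a : ℂ} {g : L2Interval ℓ}
    (h : a • one ℓ + volterra ℓ g = 0) : a = 0 ∧ g = 0 := by
  -- The continuous representative vanishes everywhere, so its value `a` at 0 does. Then `g` is the
  -- weak derivative of 0 and annihilates all test functions.
  have hpr : ∀ x ∈ Icc 0 ℓ, a + prim g x = 0 := by
    intro x hx
    refine (HasEdgeValue.unique (f := a • one ℓ + volterra ℓ g) hx hℓ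
      ⟨fun x => a + prim g x, (continuous_const.add (continuous_prim g)).continuousOn,
        coeFn_smul_one_add_volterra a g, rfl⟩ ⟨fun _ => 0, continuousOn_const, ?_, rfl⟩)
    rw [h]
    exact Lp.coeFn_zero _ _ _
  have ha : a = 0 := by simpa [prim_zero] using hpr 0 ⟨le_rfl, hℓ.le⟩
  refine ⟨ha, ?_⟩
  have hw := hasWeakDeriv_smul_one_add_volterra hℓ a g
  rw [h] at hw
  have key : ∀ᵐ x, x ∈ Ioo 0 ℓ → g x = 0 := by
    refine isOpen_Ioo.ae_eq_zero_of_integral_contDiff_smul_eq_zero ?_ ?_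
    · exact IntegrableOn.locallyIntegrableOn (integrable g)
    intro η hη hηc hηs
    have hηsupp : ∀ x ∉ Ioo 0 ℓ, η x • g x = 0 := fun x hx => by
      rw [image_eq_zero_of_notMem_tsupport fun h => hx (hηs h), zero_smul]
    rw [← setIntegral_eq_integral_of_forall_compl_eq_zero hηsupp, ← neg_eq_zero,
      ← hw η hη hηc hηs, integral_eq_zero_of_ae]
    filter_upwards [Lp.coeFn_zero ℂ 2 (volume.restrict (Ioo 0 ℓ))] with x hx
    rw [hx]; simp
  refine Lp.ext ?_
  filter_upwards [ae_restrict_mem measurableSet_Ioo, ae_restrict_of_ae key,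
    Lp.coeFn_zero ℂ 2 (volume.restrict (Ioo 0 ℓ))] with x hx h1 h2
  rw [h2, h1 hx]; rfl

theorem norm_one_pos (hℓ : 0 < ℓ) : 0 < ‖one ℓ‖ := by
  rw [norm_pos_iff]
  intro h0
  have := eq_zero_of_smul_one_add_volterra_eq_zero hℓ (a := 1) (g := 0) (by rw [h0]; simp)
  exact one_ne_zero this.1

/-- A solution of `-f'' = μ f` with vanishing Cauchy data at one end of the edge is zero. -/
theorem eq_zero_of_cauchy_data {μ : ℝ} (hμ : 0 < μ) (hℓ : 0 < ℓ) {c a : ℂ} {f g : L2Interval ℓ}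
    (hf : f = c • one ℓ + volterra ℓ g) (hg : g = a • one ℓ + volterra ℓ (-((μ : ℂ) • f)))
    (h : (c = 0 ∧ a = 0) ∨ (c + total ℓ g = 0 ∧ a + total ℓ (-((μ : ℂ) • f)) = 0)) : f = 0 := by
  set h' := -((μ : ℂ) • f) with hh'
  let u : ℝ → ℂ := fun x => c + prim g x
  let v : ℝ → ℂ := fun x => a + prim h' x
  have hu : Continuous u := continuous_const.add (continuous_prim g)
  have hv : Continuous v := continuous_const.add (continuous_prim h')
  have hfu : f =ᵐ[volume.restrict (Ioo 0 ℓ)] u := by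
    have := coeFn_smul_one_add_volterra c g
    rwa [← hf] at this
  have hgv : g =ᵐ[volume.restrict (Ioo 0 ℓ)] v := by
    have := coeFn_smul_one_add_volterra a h'
    rwa [← hg] at this
  have hhu : h' =ᵐ[volume.restrict (Ioo 0 ℓ)] fun x => -(μ • u x) := by
    filter_upwards [Lp.coeFn_neg ((μ : ℂ) • f), Lp.coeFn_smul (μ : ℂ) f, hfu] with x h1 h2 h3
    rw [hh', h1, Pi.neg_apply, h2, Pi.smul_apply, h3, smul_eq_mul, Complex.real_smul]
  have hu' : Continuous fun x => -(μ • u x) := by fun_prop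
  -- `U` and `V` coincide with `u` and `v` on [0, ℓ] but are differentiable on all of ℝ, endpoints
  -- included.
  let U : ℝ → ℂ := fun x => c + ∫ t in 0..x, v t
  let V : ℝ → ℂ := fun x => a + ∫ t in 0..x, -(μ • u t)
  have hU : ∀ x, HasDerivAt U (v x) x := fun x => (intervalIntegral.integral_hasDerivAt_right
    (hv.intervalIntegrable _ _) hv.aestronglyMeasurable.stronglyMeasurableAtFilter
    hv.continuousAt).const_add c
  have hV : ∀ x, HasDerivAt V (-(μ • u x)) x := fun x => (intervalIntegral.integral_hasDerivAt_right
    (hu'.intervalIntegrable _ _) hu'.aestronglyMeasurable.stronglyMeasurableAtFilter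
    hu'.continuousAt).const_add a
  have hUu : ∀ x ∈ Icc 0 ℓ, U x = u x := fun x hx => by
    simp only [U, u, prim_eq_intervalIntegral g hgv hx.1 hx.2]
  have hVv : ∀ x ∈ Icc 0 ℓ, V x = v x := fun x hx => by
    simp only [V, v, prim_eq_intervalIntegral h' hhu hx.1 hx.2]
  -- The oscillator energy is conserved because U' = V and V' = -μU on the edge; it vanishes at one
  -- end, hence everywhere.
  let E : ℝ → ℝ := fun x => μ * ‖U x‖ ^ 2 + ‖V x‖ ^ 2
  have hE : ∀ x ∈ Icc 0 ℓ, HasDerivAt E 0 x := fun x hx => by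
    have := ((hU x).norm_sq.const_mul μ).add (hV x).norm_sq
    rw [hUu x hx, hVv x hx] at this
    refine this.congr_deriv ?_
    rw [inner_neg_right, real_inner_smul_right, real_inner_comm]
    ring
  have hconst := constant_of_has_deriv_right_zero (f := E) (a := 0) (b := ℓ)
    (fun x hx => (hE x hx).continuousAt.continuousWithinAt)
    (fun x hx => (hE x ⟨hx.1, hx.2.le⟩).hasDerivWithinAt)
  have hE0 : E 0 = 0 := by
    rcases h with ⟨h1, h2⟩ | ⟨h1, h2⟩
    · simp [E, U, V, h1, h2]
    · rw [← hconst ℓ ⟨hℓ.le, le_rfl⟩]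
      simp only [E, hUu ℓ ⟨hℓ.le, le_rfl⟩, hVv ℓ ⟨hℓ.le, le_rfl⟩, u, v, prim_end, h1, h2]
      simp
  refine Lp.ext ?_
  filter_upwards [hfu, ae_restrict_mem measurableSet_Ioo,
    Lp.coeFn_zero ℂ 2 (volume.restrict (Ioo 0 ℓ))] with x h1 hx h2
  have hx' : x ∈ Icc 0 ℓ := ⟨hx.1.le, hx.2.le⟩
  have h3 := hconst x hx'
  rw [hE0] at h3
  have h4 : ‖U x‖ ^ 2 = 0 := by
    by_contra hne
    have : 0 < ‖U x‖ ^ 2 := lt_of_le_of_ne (sq_nonneg _) (Ne.symm hne)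
    have : 0 < E x := by positivity
    linarith
  rw [h1, h2, ← hUu x hx']
  simpa using h4

theorem isCompactOperator_smulRight {X Y : Type*} [NormedAddCommGroup X] [NormedSpace ℂ X]
    [NormedAddCommGroup Y] [NormedSpace ℂ Y] (φ : X →L[ℂ] ℂ) (y : Y) :
    IsCompactOperator (φ.smulRight y) := by
  have h : IsCompactOperator (id : ℂ → ℂ) :=
    isCompactOperator_id_iff_finiteDimensional.2 (inferInstance : FiniteDimensional ℂ ℂ)
  exact ((h.comp_clm φ).clm_comp (ContinuousLinearMap.toSpanSingleton ℂ y))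

/-- Evaluation of the primitive at `x`, as a continuous functional. -/
noncomputable def primL (ℓ x : ℝ) : L2Interval ℓ →L[ℂ] ℂ :=
  innerSL ℂ (indicatorConstLp 2 (measurableSet_Iic (a := x))
    (measure_ne_top (volume.restrict (Ioo 0 ℓ)) _) (1 : ℂ))

theorem primL_apply (x : ℝ) (g : L2Interval ℓ) : primL ℓ x g = prim g x :=
  L2.inner_indicatorConstLp_one _ _ _

/-- The finite rank operator that replaces the primitive of `g` by a step function with `n` steps
of equal length. -/
noncomputable def stepVolterra (ℓ : ℝ) (n : ℕ) : L2Interval ℓ →L[ℂ] L2Interval ℓ :=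
  ∑ j ∈ Finset.range n, (primL ℓ (j * (ℓ / n))).smulRight
    (indicatorConstLp 2 (measurableSet_Ico (a := j * (ℓ / n)) (b := (j + 1) * (ℓ / n)))
      (measure_ne_top (volume.restrict (Ioo 0 ℓ)) _) (1 : ℂ))

theorem isCompactOperator_stepVolterra (n : ℕ) : IsCompactOperator (stepVolterra ℓ n) := by
  have : stepVolterra ℓ n ∈ compactOperator (RingHom.id ℂ) (L2Interval ℓ) (L2Interval ℓ) :=
    Submodule.sum_mem _ fun j _ => isCompactOperator_smulRight _ _
  exact this

/-- On a step of length ℓ/n the primitive moves by at most √(ℓ/n)‖g‖, by its Hölder bound. -/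
theorem norm_volterra_sub_stepVolterra_le (hℓ : 0 < ℓ) {n : ℕ} (hn : 0 < n) :
    ‖volterra ℓ - stepVolterra ℓ n‖ ≤ √ℓ * √(ℓ / n) := by
  refine ContinuousLinearMap.opNorm_le_bound _ (by positivity) fun g => ?_
  rw [mul_assoc]
  refine norm_le_of_ae_bound _ (by positivity) ?_
  have hstep : ∀ᵐ x ∂volume.restrict (Ioo 0 ℓ), stepVolterra ℓ n g x =
      ∑ j ∈ Finset.range n, prim g (j * (ℓ / n)) *
        (Ico (j * (ℓ / n)) ((j + 1) * (ℓ / n))).indicator (fun _ => (1 : ℂ)) x := by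
    have h1 : stepVolterra ℓ n g = ∑ j ∈ Finset.range n, prim g (j * (ℓ / n)) •
        (indicatorConstLp 2 (measurableSet_Ico (a := j * (ℓ / n)) (b := (j + 1) * (ℓ / n)))
          (measure_ne_top (volume.restrict (Ioo 0 ℓ)) _) (1 : ℂ)) := by
      simp [stepVolterra, primL_apply]
    rw [h1]
    have h2 : ∀ j ∈ Finset.range n, ∀ᵐ x ∂volume.restrict (Ioo 0 ℓ),
        (prim g (j * (ℓ / n)) •
        (indicatorConstLp 2 (measurableSet_Ico (a := j * (ℓ / n)) (b := (j + 1) * (ℓ / n)))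
          (measure_ne_top (volume.restrict (Ioo 0 ℓ)) _) (1 : ℂ)) : L2Interval ℓ) x =
        prim g (j * (ℓ / n)) *
        (Ico (j * (ℓ / n)) ((j + 1) * (ℓ / n))).indicator (fun _ => (1 : ℂ)) x := fun j _ => by
      filter_upwards [Lp.coeFn_smul (prim g (j * (ℓ / n)))
        (indicatorConstLp 2 (measurableSet_Ico (a := j * (ℓ / n)) (b := (j + 1) * (ℓ / n)))
          (measure_ne_top (volume.restrict (Ioo 0 ℓ)) _) (1 : ℂ)),
        indicatorConstLp_coeFn (p := 2)
          (hs := measurableSet_Ico (a := j * (ℓ / n)) (b := (j + 1) * (ℓ / n)))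
          (hμs := measure_ne_top (volume.restrict (Ioo 0 ℓ)) _) (c := (1 : ℂ))] with x h3 h4
      rw [h3, Pi.smul_apply, h4, smul_eq_mul]
    rw [← Finset.eventually_all] at h2
    filter_upwards [Lp.coeFn_finsetSum (Finset.range n) fun j => prim g (j * (ℓ / n)) •
        (indicatorConstLp 2 (measurableSet_Ico (a := j * (ℓ / n)) (b := (j + 1) * (ℓ / n)))
          (measure_ne_top (volume.restrict (Ioo 0 ℓ)) _) (1 : ℂ)), h2] with x h3 h4
    rw [h3, Finset.sum_apply]
    exact Finset.sum_congr rfl h4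
  filter_upwards [hstep, coeFn_volterra g, ae_restrict_mem measurableSet_Ioo,
    Lp.coeFn_sub (volterra ℓ g) (stepVolterra ℓ n g)] with x h1 h2 hx h3
  rw [sub_apply, h3, Pi.sub_apply, h1, h2]
  have hδ : 0 < ℓ / n := by positivity
  set δ := ℓ / n with hδdef
  -- Only the step with index ⌊x/δ⌋ contains `x`, so the sum collapses to one term.
  have hx0 : 0 ≤ x / δ := div_nonneg hx.1.le hδ.le
  have hlo : (⌊x / δ⌋₊ : ℝ) * δ ≤ x := (le_div_iff₀ hδ).1 (Nat.floor_le hx0)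
  have hhi : x < (⌊x / δ⌋₊ + 1 : ℝ) * δ := (div_lt_iff₀ hδ).1 (Nat.lt_floor_add_one _)
  have hmem : ⌊x / δ⌋₊ ∈ Finset.range n := by
    rw [Finset.mem_range, Nat.floor_lt hx0, div_lt_iff₀ hδ, hδdef,
      mul_div_cancel₀ _ (by positivity)]
    exact hx.2
  rw [Finset.sum_eq_single_of_mem _ hmem, indicator_of_mem (mem_Ico.2 ⟨hlo, hhi⟩), mul_one]
  · refine (norm_prim_sub_le g hlo).trans ?_
    gcongr
    linarith
  · intro j _ hj
    rw [indicator_of_notMem, mul_zero]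
    rintro ⟨h4, h5⟩
    refine hj ?_
    rw [eq_comm, Nat.floor_eq_iff hx0]
    exact ⟨(le_div_iff₀ hδ).2 h4, (div_lt_iff₀ hδ).2 h5⟩

theorem isCompactOperator_volterra (hℓ : 0 < ℓ) : IsCompactOperator (volterra ℓ) := by
  refine isCompactOperator_of_tendsto (F := fun n => stepVolterra ℓ n) (l := Filter.atTop) ?_
    (Filter.Eventually.of_forall isCompactOperator_stepVolterra)
  rw [tendsto_iff_norm_sub_tendsto_zero]
  have hlim : Filter.Tendsto (fun n : ℕ => √ℓ * √(ℓ / n)) Filter.atTop (𝓝 0) := by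
    have h1 := tendsto_const_div_atTop_nhds_zero_nat ℓ
    have h2 := (Real.continuous_sqrt.tendsto 0).comp h1
    simpa using h2.const_mul √ℓ
  refine squeeze_zero' (Filter.Eventually.of_forall fun _ => norm_nonneg _) ?_ hlim
  filter_upwards [Filter.eventually_gt_atTop 0] with n hn
  rw [norm_sub_rev]
  exact norm_volterra_sub_stepVolterra_le hℓ hn

end L2Interval

/-! ### Abstract variational theory for a pair of operators. -/

namespace FormPencil

variable {W L : Type*} [NormedAddCommGroup W] [NormedSpace ℂ W] [NormedAddCommGroup L]
  [InnerProductSpace ℂ L] {J D : W →L[ℂ] L}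

/-- The weak eigenspace of the pencil of forms `⟪D u, D v⟫ - lam ⟪J u, J v⟫`. -/
def eigenspace (J D : W →L[ℂ] L) (lam : ℝ) : Submodule ℂ W where
  carrier := {u | ∀ v, ⟪D v, D u⟫_ℂ = lam * ⟪J v, J u⟫_ℂ}
  add_mem' := fun {u w} hu hw v => by
    simp only [map_add, inner_add_right, hu v, hw v, mul_add]
  zero_mem' := fun v => by simp
  smul_mem' := fun c u hu v => by
    simp only [map_smul, inner_smul_right, hu v]
    ring

/-- The sum of the weak eigenspaces for eigenvalues `lam ≤ μ`. -/
def spectralSpace (J D : W →L[ℂ] L) (μ : ℝ) : Submodule ℂ W :=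
  ⨆ lam : Iic μ, eigenspace J D lam

theorem eigenspace_le_spectralSpace {lam μ : ℝ} (h : lam ≤ μ) :
    eigenspace J D lam ≤ spectralSpace J D μ :=
  le_iSup (fun lam : Iic μ => eigenspace J D lam) ⟨lam, h⟩

theorem inner_eq_of_mem_eigenspace {lam : ℝ} {u : W} (hu : u ∈ eigenspace J D lam) (v : W) :
    ⟪D u, D v⟫_ℂ = lam * ⟪J u, J v⟫_ℂ := by
  rw [← inner_conj_symm, hu v, map_mul, Complex.conj_ofReal, inner_conj_symm]

theorem inner_eq_zero_of_ne {lam lam' : ℝ} {u v : W} (hu : u ∈ eigenspace J D lam)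
    (hv : v ∈ eigenspace J D lam') (h : lam ≠ lam') : ⟪J u, J v⟫_ℂ = 0 := by
  have h1 := inner_eq_of_mem_eigenspace hu v
  rw [hv u] at h1
  have h2 : ((lam' : ℂ) - lam) * ⟪J u, J v⟫_ℂ = 0 := by rw [sub_mul, h1, sub_self]
  exact (mul_eq_zero.1 h2).resolve_left (sub_ne_zero.2 (by exact_mod_cast h.symm))

/-- Eigenvectors for different eigenvalues are orthogonal under `J`, hence also under `D`, so both
norms obey Pythagoras. -/
theorem exists_decomposition {μ : ℝ} {u : W} (hu : u ∈ spectralSpace J D μ) :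
    ∃ f : Iic μ →₀ W, (∀ lam : Iic μ, f lam ∈ eigenspace J D lam) ∧ u = ∑ lam ∈ f.support, f lam ∧
      ‖J u‖ ^ 2 = ∑ lam ∈ f.support, ‖J (f lam)‖ ^ 2 ∧
      ‖D u‖ ^ 2 = ∑ lam ∈ f.support, (lam : ℝ) * ‖J (f lam)‖ ^ 2 := by
  obtain ⟨f, hf, rfl⟩ := (Submodule.mem_iSup_iff_exists_finsupp _ _).1 hu
  refine ⟨f, hf, rfl, ?_⟩
  have hJ : ∀ lam ∈ f.support, ⟪J (f.sum fun _ x => x), J (f lam)⟫_ℂ = (‖J (f lam)‖ ^ 2 : ℝ) := by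
    intro lam hlam
    rw [Finsupp.sum, map_sum, sum_inner, Finset.sum_eq_single_of_mem lam hlam,
      inner_self_eq_norm_sq_to_K]
    · norm_cast
    · intro b _ hb
      exact inner_eq_zero_of_ne (hf b) (hf lam) fun h => hb (Subtype.ext h)
  constructor
  · have h1 : ((‖J (f.sum fun _ x => x)‖ ^ 2 : ℝ) : ℂ) =
        ⟪J (f.sum fun _ x => x), J (f.sum fun _ x => x)⟫_ℂ := by
      rw [inner_self_eq_norm_sq_to_K]; norm_cast
    have h2 : ⟪J (f.sum fun _ x => x), J (f.sum fun _ x => x)⟫_ℂ =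
        ∑ lam ∈ f.support, ⟪J (f.sum fun _ x => x), J (f lam)⟫_ℂ := by
      rw [← inner_sum, ← map_sum]; rfl
    rw [h2, Finset.sum_congr rfl hJ] at h1
    exact_mod_cast h1
  · have h1 : ((‖D (f.sum fun _ x => x)‖ ^ 2 : ℝ) : ℂ) =
        ⟪D (f.sum fun _ x => x), D (f.sum fun _ x => x)⟫_ℂ := by
      rw [inner_self_eq_norm_sq_to_K]; norm_cast
    have h2 : ⟪D (f.sum fun _ x => x), D (f.sum fun _ x => x)⟫_ℂ =
        ∑ lam ∈ f.support, ⟪D (f.sum fun _ x => x), D (f lam)⟫_ℂ := by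
      rw [← inner_sum, ← map_sum]; rfl
    have h3 : ∀ lam ∈ f.support, ⟪D (f.sum fun _ x => x), D (f lam)⟫_ℂ =
        (((lam : ℝ) * ‖J (f lam)‖ ^ 2 : ℝ) : ℂ) := by
      intro lam hlam
      rw [hf lam, hJ lam hlam]
      push_cast; ring
    rw [h2, Finset.sum_congr rfl h3] at h1
    exact_mod_cast h1

theorem norm_sq_le_of_mem_spectralSpace {μ : ℝ} {u : W} (hu : u ∈ spectralSpace J D μ) :
    ‖D u‖ ^ 2 ≤ μ * ‖J u‖ ^ 2 := by
  obtain ⟨f, -, -, h1, h2⟩ := exists_decomposition hu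
  rw [h1, h2, Finset.mul_sum]
  refine Finset.sum_le_sum fun lam _ => ?_
  exact mul_le_mul_of_nonneg_right lam.2 (sq_nonneg _)

/-- Coercivity of the pair `(J, D)`. -/
def Coercive (J D : W →L[ℂ] L) : Prop := ∃ C : ℝ, ∀ u, ‖u‖ ≤ C * (‖J u‖ + ‖D u‖)

theorem Coercive.eq_zero (h : Coercive J D) {u : W} (h1 : J u = 0) (h2 : D u = 0) : u = 0 := by
  obtain ⟨C, hC⟩ := h
  have := hC u
  rw [h1, h2] at this
  simpa using this

/-- Equality of the sums forces termwise equality, so a component with eigenvalue below μ has `J` =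
0, then `D` = 0, and coercivity kills it. -/
theorem mem_eigenspace_of_norm_sq_eq (hC : Coercive J D) {μ : ℝ} {u : W}
    (hu : u ∈ spectralSpace J D μ) (h : ‖D u‖ ^ 2 = μ * ‖J u‖ ^ 2) : u ∈ eigenspace J D μ := by
  obtain ⟨f, hf, hsum, h1, h2⟩ := exists_decomposition hu
  rw [h1, h2, Finset.mul_sum] at h
  have h3 : ∀ lam ∈ f.support, (lam : ℝ) * ‖J (f lam)‖ ^ 2 = μ * ‖J (f lam)‖ ^ 2 :=
    (Finset.sum_eq_sum_iff_of_le fun lam _ =>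
      mul_le_mul_of_nonneg_right lam.2 (sq_nonneg _)).1 h
  rw [hsum]
  refine Submodule.sum_mem _ fun lam hlam => ?_
  rcases eq_or_ne (lam : ℝ) μ with he | hne
  · have := hf lam
    rwa [he] at this
  · have h4 : ‖J (f lam)‖ ^ 2 = 0 := by
      have : ((lam : ℝ) - μ) * ‖J (f lam)‖ ^ 2 = 0 := by rw [sub_mul, h3 lam hlam, sub_self]
      exact (mul_eq_zero.1 this).resolve_left (sub_ne_zero.2 hne)
    have h5 : J (f lam) = 0 := by simpa using h4
    have h6 := hf lam (f lam)
    rw [h5, inner_zero_right, mul_zero, inner_self_eq_zero] at h6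
    rw [hC.eq_zero h5 h6]
    exact Submodule.zero_mem _

/-- The Euler–Lagrange equation for a minimiser of the Rayleigh quotient on a subspace. -/
theorem inner_eq_of_minimizer {M : Submodule ℂ W} {m : ℝ} {u : W} (hu : u ∈ M)
    (hum : ‖D u‖ ^ 2 = m * ‖J u‖ ^ 2) (h : ∀ v ∈ M, m * ‖J v‖ ^ 2 ≤ ‖D v‖ ^ 2) {v : W}
    (hv : v ∈ M) : ⟪D v, D u⟫_ℂ = m * ⟪J v, J u⟫_ℂ := by
  set b : ℂ := ⟪D v, D u⟫_ℂ - m * ⟪J v, J u⟫_ℂ with hb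
  set q : ℝ := ‖D v‖ ^ 2 - m * ‖J v‖ ^ 2 with hq
  have hq0 : 0 ≤ q := sub_nonneg.2 (h v hv)
  -- Minimality is applied to u - t b v. With `b` in the coefficient, the linear term is the real
  -- number -2t‖b‖².
  have key : ∀ t : ℝ, 0 ≤ -(2 * t * ‖b‖ ^ 2) + t ^ 2 * ‖b‖ ^ 2 * q := by
    intro t
    have h1 := h (u + (-(t : ℂ) * b) • v) (M.add_mem hu (M.smul_mem _ hv))
    have h2 : ∀ T : W →L[ℂ] L, ‖T (u + (-(t : ℂ) * b) • v)‖ ^ 2 = ‖T u‖ ^ 2 -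
        2 * t * (conj b * ⟪T v, T u⟫_ℂ).re + t ^ 2 * ‖b‖ ^ 2 * ‖T v‖ ^ 2 := by
      intro T
      rw [map_add, map_smul, add_comm, norm_add_sq (𝕜 := ℂ), inner_smul_left, norm_smul, norm_mul,
        norm_neg, Complex.norm_real, mul_pow, mul_pow, Real.norm_eq_abs, sq_abs]
      have : (RCLike.re (conj (-(t : ℂ) * b) * ⟪T v, T u⟫_ℂ) : ℝ) =
          -(t * (conj b * ⟪T v, T u⟫_ℂ).re) := by
        rw [(starRingEnd ℂ).map_mul, map_neg, Complex.conj_ofReal, neg_mul, neg_mul, mul_assoc]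
        exact (Complex.neg_re _).trans (congrArg _ (Complex.re_ofReal_mul _ _))
      rw [this]; ring
    rw [h2, h2, hum] at h1
    have h3 : ‖b‖ ^ 2 = (conj b * ⟪D v, D u⟫_ℂ).re - m * (conj b * ⟪J v, J u⟫_ℂ).re := by
      have : (conj b * b).re = ‖b‖ ^ 2 := by
        rw [mul_comm, Complex.mul_conj, Complex.ofReal_re, Complex.normSq_eq_norm_sq]
      rw [← this]
      nth_rewrite 2 [hb]
      rw [mul_sub, Complex.sub_re, mul_left_comm, Complex.re_ofReal_mul]
    rw [hq]
    linear_combination h1 + 2 * t * h3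
  -- This t makes the right side -‖b‖²(q+2)/(q+1)², negative unless b = 0; it is also admissible
  -- when q = 0.
  have h1 := key (1 / (q + 1))
  have hb0 : ‖b‖ ^ 2 = 0 := by
    by_contra hne
    have hpos : 0 < ‖b‖ ^ 2 := lt_of_le_of_ne (sq_nonneg _) (Ne.symm hne)
    have : -(2 * (1 / (q + 1)) * ‖b‖ ^ 2) + (1 / (q + 1)) ^ 2 * ‖b‖ ^ 2 * q =
        -(‖b‖ ^ 2 * (q + 2) / (q + 1) ^ 2) := by
      field_simp; ring
    rw [this] at h1
    have : 0 < ‖b‖ ^ 2 * (q + 2) / (q + 1) ^ 2 := by positivity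
    linarith
  have hb1 : b = 0 := by simpa using hb0
  exact sub_eq_zero.1 hb1

/-- The Rayleigh quotient `‖D u‖² / ‖J u‖²` attains its minimum on a closed subspace. -/
theorem exists_minimizer [CompleteSpace W] (hJ : IsCompactOperator J) (hC : Coercive J D)
    {M : Submodule ℂ W} (hM : IsClosed (M : Set W)) (hne : ∃ u ∈ M, J u ≠ 0) :
    ∃ u ∈ M, ‖J u‖ = 1 ∧ ∃ m : ℝ, ‖D u‖ ^ 2 = m ∧ ∀ v ∈ M, m * ‖J v‖ ^ 2 ≤ ‖D v‖ ^ 2 := by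
  set A : Set ℝ := {r | ∃ u ∈ M, ‖J u‖ = 1 ∧ ‖D u‖ ^ 2 = r} with hA
  have hscale : ∀ v ∈ M, J v ≠ 0 → ‖D v‖ ^ 2 / ‖J v‖ ^ 2 ∈ A := by
    intro v hv hv0
    have hn : ‖J v‖ ≠ 0 := norm_ne_zero_iff.2 hv0
    refine ⟨((‖J v‖⁻¹ : ℝ) : ℂ) • v, M.smul_mem _ hv, ?_, ?_⟩
    · rw [map_smul, norm_smul, Complex.norm_real, norm_inv, norm_norm, inv_mul_cancel₀ hn]
    · rw [map_smul, norm_smul, Complex.norm_real, norm_inv, norm_norm, mul_pow, inv_pow]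
      field_simp
  have hAne : A.Nonempty := by
    obtain ⟨u, hu, hu0⟩ := hne
    exact ⟨_, hscale u hu hu0⟩
  have hAbdd : BddBelow A := ⟨0, by rintro r ⟨u, -, -, rfl⟩; positivity⟩
  set m := sInf A with hm
  have hmle : ∀ v ∈ M, m * ‖J v‖ ^ 2 ≤ ‖D v‖ ^ 2 := by
    intro v hv
    by_cases hv0 : J v = 0
    · rw [hv0]; simp
    · have hn : 0 < ‖J v‖ := norm_pos_iff.2 hv0
      rw [← le_div_iff₀ (by positivity)]
      exact csInf_le hAbdd (hscale v hv hv0)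
  obtain ⟨ρ, hanti, hlim, hmem⟩ := exists_seq_tendsto_sInf hAne hAbdd
  choose w hwM hwJ hwD using hmem
  obtain ⟨C, hCle⟩ := hC
  have hC0 : 0 ≤ C := by
    have h1 := hCle (w 0)
    have h2 : 0 < ‖J (w 0)‖ + ‖D (w 0)‖ := by rw [hwJ]; positivity
    by_contra hneg
    have h3 : C * (‖J (w 0)‖ + ‖D (w 0)‖) < 0 := mul_neg_of_neg_of_pos (not_le.1 hneg) h2
    linarith [norm_nonneg (w 0)]
  have hbound : ∀ n, w n ∈ Metric.closedBall (0 : W) (C * (1 + √(ρ 0))) := by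
    intro n
    rw [mem_closedBall_zero_iff]
    refine (hCle _).trans ?_
    rw [hwJ]
    gcongr
    rw [← Real.sqrt_sq (norm_nonneg (D (w n))), hwD]
    exact Real.sqrt_le_sqrt (hanti (Nat.zero_le n))
  -- Compactness gives convergence of `J` along a subsequence of the minimising sequence.
  obtain ⟨K, hK, hKsub⟩ := hJ.image_closedBall_subset_compact (C * (1 + √(ρ 0)))
  obtain ⟨y, -, φ, hφ, hy⟩ := hK.tendsto_subseq (x := fun n => J (w n))
    fun n => hKsub ⟨w n, hbound n, rfl⟩
  -- The parallelogram law for `D`, with the lower bound m for the quotient at s i + s j, controls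
  -- ‖D(s i - s j)‖. Coercivity then makes the subsequence Cauchy in W, without weak limits.
  set s : ℕ → W := fun n => w (φ n) with hs
  have hρφ : Filter.Tendsto (fun n => ρ (φ n)) Filter.atTop (𝓝 m) := hlim.comp hφ.tendsto_atTop
  have hdist : ∀ i j, dist (s i) (s j) ≤ C * (dist (J (s i)) (J (s j)) +
      √(2 * (ρ (φ i) - m) + 2 * (ρ (φ j) - m) + m * dist (J (s i)) (J (s j)) ^ 2)) := by
    intro i j
    simp only [dist_eq_norm]
    refine (hCle _).trans ?_
    rw [map_sub, map_sub]
    gcongr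
    refine Real.le_sqrt_of_sq_le ?_
    have h1 := parallelogram_law_with_norm ℂ (D (s i)) (D (s j))
    have h2 := parallelogram_law_with_norm ℂ (J (s i)) (J (s j))
    have h3 := hmle (s i + s j) (M.add_mem (hwM _) (hwM _))
    rw [map_add, map_add] at h3
    have e1 : ‖J (s i)‖ ^ 2 = 1 := by rw [hs]; simp only [hwJ]; norm_num
    have e2 : ‖J (s j)‖ ^ 2 = 1 := by rw [hs]; simp only [hwJ]; norm_num
    have e3 : ‖D (s i)‖ ^ 2 = ρ (φ i) := hwD _
    have e4 : ‖D (s j)‖ ^ 2 = ρ (φ j) := hwD _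
    rw [e1, e2] at h2
    rw [e3, e4] at h1
    have h4 : ‖J (s i) + J (s j)‖ ^ 2 = 4 - ‖J (s i) - J (s j)‖ ^ 2 := by linarith
    rw [h4] at h3
    linarith
  have hcauchy : CauchySeq s := by
    rw [cauchySeq_iff_tendsto_dist_atTop_0]
    refine squeeze_zero (fun _ => dist_nonneg) (fun n => hdist n.1 n.2) ?_
    have hJc : CauchySeq fun n => J (s n) := hy.cauchySeq
    have h1 := cauchySeq_iff_tendsto_dist_atTop_0.1 hJc
    rw [← Filter.prod_atTop_atTop_eq] at h1 ⊢
    have h2 : Filter.Tendsto (fun n : ℕ × ℕ => ρ (φ n.1)) (Filter.atTop ×ˢ Filter.atTop) (𝓝 m) :=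
      hρφ.comp Filter.tendsto_fst
    have h3 : Filter.Tendsto (fun n : ℕ × ℕ => ρ (φ n.2)) (Filter.atTop ×ˢ Filter.atTop) (𝓝 m) :=
      hρφ.comp Filter.tendsto_snd
    have h4 := ((((h2.sub_const m).const_mul 2).add ((h3.sub_const m).const_mul 2)).add
      ((h1.pow 2).const_mul m)).sqrt
    have h5 := (h1.add h4).const_mul C
    simpa using h5
  obtain ⟨u, hu⟩ := cauchySeq_tendsto_of_complete hcauchy
  refine ⟨u, hM.mem_of_tendsto hu (Filter.Eventually.of_forall fun n => hwM _), ?_, m, ?_, hmle⟩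
  · have h1 := ((J.continuous.tendsto u).comp hu).norm
    refine tendsto_nhds_unique h1 ?_
    simp [hs, hwJ]
  · have h1 := (((D.continuous.tendsto u).comp hu).norm).pow 2
    refine tendsto_nhds_unique h1 ?_
    simpa [hs, Function.comp_def, hwD] using hρφ

/-- Spectral gap: if there are finitely many eigenvalues in `(-∞, μ]`, then the Rayleigh quotient on
the complement of the spectral subspace is bounded below by a number greater than `μ`. -/
theorem exists_gap [CompleteSpace W] (hJ : IsCompactOperator J) (hC : Coercive J D) {μ : ℝ}
    [FiniteDimensional ℂ (spectralSpace J D μ)] :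
    ∃ μ' > μ, ∀ u, (∀ s ∈ spectralSpace J D μ, ⟪J s, J u⟫_ℂ = 0) →
      μ' * ‖J u‖ ^ 2 ≤ ‖D u‖ ^ 2 := by
  set S := spectralSpace J D μ with hS
  let K : Submodule ℂ L := S.map (J : W →ₗ[ℂ] L)
  let M : Submodule ℂ W := Kᗮ.comap (J : W →ₗ[ℂ] L)
  have hMmem : ∀ u, u ∈ M ↔ ∀ s ∈ S, ⟪J s, J u⟫_ℂ = 0 := by
    intro u
    simp only [M, K, Submodule.mem_comap, Submodule.mem_orthogonal, Submodule.mem_map]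
    constructor
    · intro h s hs
      exact h _ ⟨s, hs, rfl⟩
    · rintro h _ ⟨s, hs, rfl⟩
      exact h s hs
  have hMclosed : IsClosed (M : Set W) := K.isClosed_orthogonal.preimage J.continuous
  by_cases hne : ∃ u ∈ M, J u ≠ 0
  · obtain ⟨u, hu, hu1, m, hum, hmin⟩ := exists_minimizer hJ hC hMclosed hne
    -- For an eigenvector s, orthogonality under `J` gives orthogonality under `D`; by linearity
    -- this extends to the spectral space.
    have hMS : ∀ s ∈ S, ⟪D s, D u⟫_ℂ = 0 := by
      have h0 : S ≤ (ℂ ∙ D u)ᗮ.comap (D : W →ₗ[ℂ] L) := by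
        rw [hS, spectralSpace, iSup_le_iff]
        intro lam s hs
        rw [Submodule.mem_comap, Submodule.mem_orthogonal_singleton_iff_inner_left]
        have h1 := inner_eq_of_mem_eigenspace hs u
        rw [(hMmem u).1 hu s (eigenspace_le_spectralSpace lam.2 hs), mul_zero] at h1
        exact h1
      intro s hs
      exact Submodule.mem_orthogonal_singleton_iff_inner_left.1 (h0 hs)
    have heig : u ∈ eigenspace J D m := by
      intro v
      -- Any test vector v splits into s in the spectral space, where both forms against u vanish,
      -- and v - s in `M`, where the Euler–Lagrange equation holds. So u is a genuine eigenvector.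
      obtain ⟨s, hs, hsv⟩ : K.starProjection (J v) ∈ K := K.starProjection_apply_mem _
      have hvs : v - s ∈ M := by
        change J (v - s) ∈ Kᗮ
        rw [map_sub]
        have : J s = K.starProjection (J v) := hsv
        rw [this]
        exact K.sub_starProjection_mem_orthogonal _
      have h1 := inner_eq_of_minimizer hu (by rw [hum, hu1]; ring) hmin hvs
      rw [map_sub, map_sub, inner_sub_left, inner_sub_left, hMS s hs, (hMmem u).1 hu s hs,
        sub_zero, sub_zero] at h1
      exact h1
    refine ⟨m, ?_, fun v hv => hmin v ((hMmem v).2 hv)⟩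
    -- If m ≤ μ, then u lies in the spectral space to which it is orthogonal, contradicting ‖J u‖ =
    -- 1.
    by_contra hle
    have h1 := (hMmem u).1 hu u (eigenspace_le_spectralSpace (not_lt.1 hle) heig)
    rw [inner_self_eq_zero] at h1
    rw [h1, norm_zero] at hu1
    exact zero_ne_one hu1
  · push Not at hne
    refine ⟨μ + 1, by simp, fun u hu => ?_⟩
    rw [hne u ((hMmem u).2 hu)]
    simp

/-- Orthogonality imposes fewer than k linear conditions on k parameters. -/
theorem exists_ne_zero_orthogonal {k : ℕ} (T : (Fin k → ℂ) →ₗ[ℂ] W) (S : Submodule ℂ W)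
    [FiniteDimensional ℂ S] (hS : Module.finrank ℂ S < k) :
    ∃ x ≠ 0, ∀ s ∈ S, ⟪J s, J (T x)⟫_ℂ = 0 := by
  let K : Submodule ℂ L := S.map (J : W →ₗ[ℂ] L)
  have hK : Module.finrank ℂ K < k := (Submodule.finrank_map_le _ _).trans_lt hS
  let P : (Fin k → ℂ) →ₗ[ℂ] K := (K.orthogonalProjectionOnto : L →ₗ[ℂ] K) ∘ₗ (J : W →ₗ[ℂ] L) ∘ₗ T
  have hP : LinearMap.ker P ≠ ⊥ := P.ker_ne_bot_of_finrank_lt (by simpa using hK)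
  obtain ⟨x, hx, hx0⟩ := (Submodule.ne_bot_iff _).1 hP
  refine ⟨x, hx0, fun s hs => ?_⟩
  have h1 : K.orthogonalProjectionOnto (J (T x)) = 0 := hx
  rw [Submodule.orthogonalProjectionOnto_eq_zero_iff] at h1
  exact (Submodule.mem_orthogonal _ _).1 h1 _ ⟨s, hs, rfl⟩

theorem finrank_lt_of_not_le_rank {k : ℕ} {S : Submodule ℂ W}
    (h : ¬ (k : Cardinal) ≤ Module.rank ℂ S) :
    FiniteDimensional ℂ S ∧ Module.finrank ℂ S < k := by
  rw [not_le] at h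
  have hfd : FiniteDimensional ℂ S :=
    Module.rank_lt_aleph0_iff.1 (h.trans (Cardinal.natCast_lt_aleph0))
  refine ⟨hfd, ?_⟩
  rw [← Module.finrank_eq_rank] at h
  exact_mod_cast h

/-- The bound μ' is chosen before `T`. This uniformity is what `sInf_mem` needs, where `T` depends
on a spectral bound chosen below μ'. -/
theorem exists_gap_of_not_le_rank [CompleteSpace W] (hJ : IsCompactOperator J) (hC : Coercive J D)
    {k : ℕ} {μ : ℝ} (h : ¬ (k : Cardinal) ≤ Module.rank ℂ (spectralSpace J D μ)) :
    ∃ μ' > μ, ∀ T : (Fin k → ℂ) →ₗ[ℂ] W, ∃ x ≠ 0, μ' * ‖J (T x)‖ ^ 2 ≤ ‖D (T x)‖ ^ 2 := by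
  obtain ⟨hfd, hlt⟩ := finrank_lt_of_not_le_rank h
  obtain ⟨μ', hμ', hgap⟩ := exists_gap (J := J) (D := D) hJ hC (μ := μ)
  refine ⟨μ', hμ', fun T => ?_⟩
  obtain ⟨x, hx0, hx⟩ := exists_ne_zero_orthogonal (J := J) T _ hlt
  exact ⟨x, hx0, hgap _ hx⟩

theorem Coercive.eq_zero_of_le (hC : Coercive J D) {ν μ : ℝ} (h : ν < μ) {u : W}
    (h1 : ‖D u‖ ^ 2 ≤ ν * ‖J u‖ ^ 2) (h2 : μ * ‖J u‖ ^ 2 ≤ ‖D u‖ ^ 2) : u = 0 := by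
  have h3 : ‖J u‖ ^ 2 = 0 := by
    by_contra hne
    have hpos : 0 < ‖J u‖ ^ 2 := lt_of_le_of_ne (sq_nonneg _) (Ne.symm hne)
    nlinarith
  rw [h3, mul_zero] at h1
  have h4 : ‖D u‖ ^ 2 = 0 := le_antisymm h1 (sq_nonneg _)
  exact hC.eq_zero (by simpa using h3) (by simpa using h4)

/-- The variational principle. -/
theorem le_rank_spectralSpace [CompleteSpace W] (hJ : IsCompactOperator J) (hC : Coercive J D)
    {k : ℕ} {μ : ℝ} (T : (Fin k → ℂ) →ₗ[ℂ] W) (hT : Function.Injective T)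
    (h : ∀ x, ‖D (T x)‖ ^ 2 ≤ μ * ‖J (T x)‖ ^ 2) :
    (k : Cardinal) ≤ Module.rank ℂ (spectralSpace J D μ) := by
  by_contra hlt
  obtain ⟨μ', hμ', hgap⟩ := exists_gap_of_not_le_rank hJ hC hlt
  obtain ⟨x, hx0, hx⟩ := hgap T
  exact hx0 (hT ((hC.eq_zero_of_le hμ' (h x) hx).trans (map_zero T).symm))

/-- The spectral bounds with at least `k` eigenvalues below form a set that contains its infimum. -/
theorem sInf_mem [CompleteSpace W] (hJ : IsCompactOperator J) (hC : Coercive J D) {k : ℕ}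
    (hne : {μ : ℝ | (k : Cardinal) ≤ Module.rank ℂ (spectralSpace J D μ)}.Nonempty) :
    (k : Cardinal) ≤ Module.rank ℂ (spectralSpace J D
      (sInf {μ : ℝ | (k : Cardinal) ≤ Module.rank ℂ (spectralSpace J D μ)})) := by
  by_contra hlt
  obtain ⟨μ', hμ', hgap⟩ := exists_gap_of_not_le_rank hJ hC hlt
  obtain ⟨ν, hν, hνlt⟩ := exists_lt_of_csInf_lt hne hμ'
  obtain ⟨f, hf⟩ := Module.le_rank_iff_exists_linearMap.1 hν
  obtain ⟨x, hx0, hx⟩ := hgap ((spectralSpace J D ν).subtype ∘ₗ f)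
  have h1 := hC.eq_zero_of_le hνlt (norm_sq_le_of_mem_spectralSpace (f x).2) hx
  exact hx0 (hf (Subtype.ext (by simpa using h1)))

/-- The forms are nonnegative, so there are no eigenvectors below 0. For k = 0 every real μ would
qualify, hence 1 ≤ k. -/
theorem bddBelow {k : ℕ} (hC : Coercive J D) (hk : 1 ≤ k) :
    BddBelow {μ : ℝ | (k : Cardinal) ≤ Module.rank ℂ (spectralSpace J D μ)} := by
  refine ⟨0, fun μ hμ => ?_⟩
  by_contra hneg
  have hbot : spectralSpace J D μ = ⊥ := by
    rw [Submodule.eq_bot_iff]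
    intro u hu
    exact hC.eq_zero_of_le (not_le.1 hneg) (norm_sq_le_of_mem_spectralSpace hu)
      (by rw [zero_mul]; positivity)
  rw [mem_ofPred_eq, hbot, rank_bot] at hμ
  have : k ≤ 0 := by exact_mod_cast hμ
  omega

/-- On a finite-dimensional space the Rayleigh quotient attains its maximum. -/
theorem exists_max_rayleigh {k : ℕ} (hk : 1 ≤ k) (T : (Fin k → ℂ) →ₗ[ℂ] W)
    (hT : ∀ x ≠ 0, J (T x) ≠ 0) :
    ∃ μ : ℝ, (∀ x, ‖D (T x)‖ ^ 2 ≤ μ * ‖J (T x)‖ ^ 2) ∧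
      ∃ x ≠ 0, ‖D (T x)‖ ^ 2 = μ * ‖J (T x)‖ ^ 2 := by
  have hTc : Continuous T := T.continuous_of_finiteDimensional
  have hpos : ∀ x ≠ 0, 0 < ‖J (T x)‖ ^ 2 := fun x hx => by
    have := norm_pos_iff.2 (hT x hx)
    positivity
  have : Nonempty (Fin k) := ⟨⟨0, hk⟩⟩
  have hsne : (Metric.sphere (0 : Fin k → ℂ) 1).Nonempty := NormedSpace.sphere_nonempty.2 zero_le_one
  have hs0 : ∀ x ∈ Metric.sphere (0 : Fin k → ℂ) 1, x ≠ 0 := fun x hx h0 => by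
    rw [h0] at hx; simp at hx
  -- The quotient is homogeneous of degree zero, so the compact unit sphere suffices.
  obtain ⟨x, hx, hmax⟩ := (isCompact_sphere (0 : Fin k → ℂ) 1).exists_isMaxOn hsne
    (f := fun x => ‖D (T x)‖ ^ 2 / ‖J (T x)‖ ^ 2)
    (ContinuousOn.div (by fun_prop) (by fun_prop) fun x hx => (hpos x (hs0 x hx)).ne')
  refine ⟨‖D (T x)‖ ^ 2 / ‖J (T x)‖ ^ 2, fun y => ?_, x, hs0 x hx, ?_⟩
  · by_cases hy : y = 0
    · simp [hy]
    have hn : ‖y‖ ≠ 0 := norm_ne_zero_iff.2 hy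
    have hmem : ((‖y‖⁻¹ : ℝ) : ℂ) • y ∈ Metric.sphere (0 : Fin k → ℂ) 1 := by
      rw [mem_sphere_zero_iff_norm, norm_smul, Complex.norm_real, norm_inv, norm_norm,
        inv_mul_cancel₀ hn]
    have h1 := hmax hmem
    simp only [mem_ofPred_eq, map_smul, norm_smul, Complex.norm_real, norm_inv, norm_norm,
      mul_pow] at h1
    rw [mul_div_mul_left _ _ (by positivity), div_le_iff₀ (hpos y hy)] at h1
    exact h1
  · rw [div_mul_cancel₀ _ (hpos x (hs0 x hx)).ne']

end FormPencil

/-! ### The space H¹(G) and the min-max principle for the standard Laplacian. -/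

namespace MetricGraph

open L2Interval FormPencil

variable {V E : Type*}

section

variable (G : MetricGraph V E)

/-- The defect of `c (t e) = c (o e) + ∫ g_e` for vertex values `c` and edgewise derivatives `g`. -/
noncomputable def edgeDefect (e : E) : (V → ℂ) × G.L2 →L[ℂ] ℂ :=
  ((ContinuousLinearMap.proj (G.t e) : (V → ℂ) →L[ℂ] ℂ) - ContinuousLinearMap.proj (G.o e)) ∘L
      ContinuousLinearMap.fst ℂ (V → ℂ) G.L2 -
    total (G.len e) ∘L PiLp.proj 2 (fun e => L2Interval (G.len e)) e ∘L
      ContinuousLinearMap.snd ℂ (V → ℂ) G.L2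

/-- The Sobolev space `H¹(G)` of continuous functions on `G`, which are represented by their vertex
values and their edgewise derivatives. -/
noncomputable def H1 : Submodule ℂ ((V → ℂ) × G.L2) :=
  ⨅ e, LinearMap.ker (G.edgeDefect e : (V → ℂ) × G.L2 →ₗ[ℂ] ℂ)

theorem mem_H1 {u : (V → ℂ) × G.L2} :
    u ∈ G.H1 ↔ ∀ e, u.1 (G.o e) + total (G.len e) (u.2 e) = u.1 (G.t e) := by
  simp only [H1, Submodule.mem_iInf, LinearMap.mem_ker]
  refine forall_congr' fun e => ?_
  change u.1 (G.t e) - u.1 (G.o e) - total (G.len e) (u.2 e) = 0 ↔ _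
  rw [sub_sub, sub_eq_zero, eq_comm]

theorem isClosed_H1 : IsClosed (G.H1 : Set ((V → ℂ) × G.L2)) := by
  simp only [H1, Submodule.coe_iInf]
  exact isClosed_iInter fun e => (G.edgeDefect e).isClosed_ker

/-- The function on the edge `e` with given vertex values and derivatives. -/
noncomputable def edgeFun (e : E) : (V → ℂ) × G.L2 →L[ℂ] L2Interval (G.len e) :=
  ((ContinuousLinearMap.proj (G.o e) : (V → ℂ) →L[ℂ] ℂ) ∘L
    ContinuousLinearMap.fst ℂ (V → ℂ) G.L2).smulRight
      (one (G.len e)) +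
    volterra (G.len e) ∘L PiLp.proj 2 (fun e => L2Interval (G.len e)) e ∘L
      ContinuousLinearMap.snd ℂ (V → ℂ) G.L2

/-- The embedding of the `e`-th summand in `L²(G)`. -/
noncomputable def single (e : E) : L2Interval (G.len e) →L[ℂ] G.L2 := by
  classical
  exact ((PiLp.continuousLinearEquiv 2 ℂ fun e => L2Interval (G.len e)).symm :
    (∀ e, L2Interval (G.len e)) →L[ℂ] G.L2) ∘L
      ContinuousLinearMap.single ℂ (fun e => L2Interval (G.len e)) e

theorem single_apply_same (e : E) (g : L2Interval (G.len e)) : G.single e g e = g := by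
  classical
  exact Pi.single_eq_same (M := fun e => L2Interval (G.len e)) e g

theorem single_apply_ne {e e' : E} (h : e' ≠ e) (g : L2Interval (G.len e)) :
    G.single e g e' = 0 := by
  classical
  exact Pi.single_eq_of_ne (M := fun e => L2Interval (G.len e)) h g

/-- The embedding `H¹(G) → L²(G)`. -/
noncomputable def toL2 : G.H1 →L[ℂ] G.L2 :=
  (((PiLp.continuousLinearEquiv 2 ℂ fun e => L2Interval (G.len e)).symm :
    (∀ e, L2Interval (G.len e)) →L[ℂ] G.L2) ∘L ContinuousLinearMap.pi G.edgeFun) ∘L G.H1.subtypeL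

/-- The edgewise derivative `H¹(G) → L²(G)`. -/
noncomputable def derivL2 : G.H1 →L[ℂ] G.L2 :=
  ContinuousLinearMap.snd ℂ (V → ℂ) G.L2 ∘L G.H1.subtypeL

theorem toL2_apply (u : G.H1) (e : E) :
    G.toL2 u e = u.1.1 (G.o e) • one (G.len e) + volterra (G.len e) (u.1.2 e) := rfl

theorem derivL2_apply (u : G.H1) : G.derivL2 u = u.1.2 := rfl

theorem hasVertexValues_toL2 (u : G.H1) : G.HasVertexValues (G.toL2 u) u.1.1 := by
  intro e
  rw [toL2_apply]
  refine ⟨hasEdgeValue_smul_one_add_volterra_zero _ _, ?_⟩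
  have := hasEdgeValue_smul_one_add_volterra_end (u.1.1 (G.o e)) (u.1.2 e)
  rwa [G.mem_H1.1 u.2 e] at this

/-- Incidence is needed because the value at an isolated vertex leaves no trace in L²(G). -/
theorem toL2_eq_zero {u : G.H1} (hG : ∀ v, ∃ e, G.o e = v ∨ G.t e = v) (h : G.toL2 u = 0) :
    u = 0 := by
  have h1 : ∀ e, u.1.1 (G.o e) = 0 ∧ u.1.2 e = 0 := fun e => by
    refine eq_zero_of_smul_one_add_volterra_eq_zero (G.len_pos e) ?_
    rw [← toL2_apply, h]; rfl
  refine Subtype.ext (Prod.ext (funext fun v => ?_) (PiLp.ext fun e => (h1 e).2))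
  obtain ⟨e, rfl | rfl⟩ := hG v
  · exact (h1 e).1
  · rw [← G.mem_H1.1 u.2 e, (h1 e).1, (h1 e).2, map_zero, add_zero]; rfl

/-- Integration by parts on `G`. -/
theorem inner_derivL2_add_inner_toL2 [Fintype E] (v : G.H1) {p h : G.L2} {a : E → ℂ}
    (hp : ∀ e, p e = a e • one (G.len e) + volterra (G.len e) (h e)) :
    ⟪G.derivL2 v, p⟫_ℂ + ⟪G.toL2 v, h⟫_ℂ = ∑ e, (conj (v.1.1 (G.t e)) *
      (a e + total (G.len e) (h e)) - conj (v.1.1 (G.o e)) * a e) := by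
  rw [PiLp.inner_apply, PiLp.inner_apply, ← Finset.sum_add_distrib]
  refine Finset.sum_congr rfl fun e _ => ?_
  rw [hp e, toL2_apply, derivL2_apply, inner_add_inner_eq, (G.mem_H1.1 v.2 e)]

end

section

variable [Fintype V] [Fintype E] (G : MetricGraph V E)

theorem isCompactOperator_edgeFun (e : E) : IsCompactOperator (G.edgeFun e) :=
  IsCompactOperator.add (f := ((ContinuousLinearMap.proj (G.o e) : (V → ℂ) →L[ℂ] ℂ) ∘L
    ContinuousLinearMap.fst ℂ (V → ℂ) G.L2).smulRight (one (G.len e)))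
    (isCompactOperator_smulRight _ _)
    ((isCompactOperator_volterra (G.len_pos e)).comp_clm
      (PiLp.proj 2 (fun e => L2Interval (G.len e)) e ∘L ContinuousLinearMap.snd ℂ (V → ℂ) G.L2))

theorem isCompactOperator_toL2 : IsCompactOperator G.toL2 := by
  have h1 : G.toL2 = ∑ e, G.single e ∘L G.edgeFun e ∘L G.H1.subtypeL := by
    ext1 u
    refine PiLp.ext fun e => ?_
    rw [sum_apply, WithLp.ofLp_sum, Finset.sum_apply,
      Finset.sum_eq_single_of_mem e (Finset.mem_univ e)]
    · exact (G.single_apply_same e _).symm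
    · intro e' _ he
      exact G.single_apply_ne he.symm _
  rw [h1]
  have : ∑ e, G.single e ∘L G.edgeFun e ∘L G.H1.subtypeL ∈
      compactOperator (RingHom.id ℂ) G.H1 G.L2 :=
    Submodule.sum_mem _ fun e _ =>
      ((G.isCompactOperator_edgeFun e).comp_clm G.H1.subtypeL).clm_comp (G.single e)
  exact this

/-- Regularity of weak eigenfunctions: test functions on a single edge give the differential
equation, hat functions at a vertex give Kirchhoff's condition. -/
theorem isStandardLaplacian_of_mem_eigenspace {u : G.H1} {lam : ℝ}
    (hu : u ∈ eigenspace G.toL2 G.derivL2 lam) :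
    G.IsStandardLaplacian (G.toL2 u) ((lam : ℂ) • G.toL2 u) := by
  classical
  set f := G.toL2 u with hf
  set h : G.L2 := -((lam : ℂ) • f) with hh
  have hedge : ∀ e, ∃ a : ℂ, u.1.2 e = a • one (G.len e) + volterra (G.len e) (h e) := by
    intro e
    -- A mean-zero `w` is the derivative of a function vanishing at both ends of e, which extends by
    -- zero to H¹(G). Being orthogonal to all such `w` means being constant.
    have horth : u.1.2 e - volterra (G.len e) (h e) ∈ (ℂ ∙ one (G.len e))ᗮᗮ := by
      rw [Submodule.mem_orthogonal]
      intro w hw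
      rw [Submodule.mem_orthogonal_singleton_iff_inner_right] at hw
      have htot : total (G.len e) w = 0 := hw
      let v : G.H1 := ⟨(0, G.single e w), G.mem_H1.2 fun e' => by
        change (0 : ℂ) + total (G.len e') (G.single e w e') = 0
        rcases eq_or_ne e' e with rfl | hne
        · rw [single_apply_same, htot, add_zero]
        · rw [G.single_apply_ne hne, map_zero, add_zero]⟩
      have h1 : ⟪w, u.1.2 e⟫_ℂ = lam * ⟪volterra (G.len e) w, f e⟫_ℂ := by
        have h2 := hu v
        rw [PiLp.inner_apply, PiLp.inner_apply,
          Finset.sum_eq_single_of_mem e (Finset.mem_univ e),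
          Finset.sum_eq_single_of_mem e (Finset.mem_univ e)] at h2
        · have h3 : G.toL2 v e = volterra (G.len e) w := by
            rw [toL2_apply]
            change (0 : ℂ) • one (G.len e) + volterra (G.len e) (G.single e w e) = _
            rw [single_apply_same, zero_smul, zero_add]
          have h4 : G.derivL2 v e = w := G.single_apply_same e w
          rw [h3, h4] at h2
          exact h2
        · intro e' _ hne
          have h3 : G.toL2 v e' = 0 := by
            rw [toL2_apply]
            change (0 : ℂ) • one (G.len e') + volterra (G.len e') (G.single e w e') = _
            rw [G.single_apply_ne hne, zero_smul, zero_add, map_zero]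
          rw [h3, inner_zero_left]
        · intro e' _ hne
          have h4 : G.derivL2 v e' = 0 := G.single_apply_ne hne w
          rw [h4, inner_zero_left]
      have h5 := inner_volterra_add w (h e)
      have h6 : h e = -((lam : ℂ) • f e) := rfl
      rw [htot, map_zero, zero_mul] at h5
      rw [inner_sub_right, h1, eq_neg_of_add_eq_zero_right h5, h6, inner_neg_right,
        inner_smul_right]
      ring
    rw [Submodule.orthogonal_orthogonal, Submodule.mem_span_singleton] at horth
    obtain ⟨a, ha⟩ := horth
    exact ⟨a, by rw [ha, sub_add_cancel]⟩
  choose a ha using hedge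
  refine ⟨u.1.2, fun e => ?_, fun e => ?_, ⟨_, G.hasVertexValues_toL2 u⟩, a,
    fun e => a e + total (G.len e) (h e), fun e => ?_, fun v => ?_⟩
  · rw [hf, toL2_apply]
    exact hasWeakDeriv_smul_one_add_volterra (G.len_pos e) _ _
  · rw [ha e]
    exact hasWeakDeriv_smul_one_add_volterra (G.len_pos e) _ _
  · rw [ha e]
    exact ⟨hasEdgeValue_smul_one_add_volterra_zero _ _,
      hasEdgeValue_smul_one_add_volterra_end _ _⟩
  -- The hat function: 1 at `v`, 0 at other vertices, affine on edges. The divisor is the edge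
  -- length, written as the integral of 1.
  · let c : V → ℂ := Pi.single v 1
    let w : G.H1 := ⟨(c, WithLp.toLp 2 fun e =>
        ((c (G.t e) - c (G.o e)) / total (G.len e) (one (G.len e))) • one (G.len e)),
      G.mem_H1.2 fun e => by
        change c (G.o e) + total (G.len e)
          (((c (G.t e) - c (G.o e)) / total (G.len e) (one (G.len e))) • one (G.len e)) = c (G.t e)
        have hne : total (G.len e) (one (G.len e)) ≠ 0 := by
          rw [total_eq_inner, inner_self_ne_zero, ← norm_pos_iff]
          exact norm_one_pos (G.len_pos e)
        rw [map_smul, smul_eq_mul, div_mul_cancel₀ _ hne]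
        ring⟩
    have h1 := G.inner_derivL2_add_inner_toL2 w ha
    have h2 : ⟪G.derivL2 w, u.1.2⟫_ℂ = lam * ⟪G.toL2 w, f⟫_ℂ := hu w
    have h3 : ⟪G.toL2 w, h⟫_ℂ = -(lam * ⟪G.toL2 w, f⟫_ℂ) := by
      rw [hh, inner_neg_right, inner_smul_right]
    rw [h2, h3, add_neg_cancel, Finset.sum_sub_distrib] at h1
    rw [h1, Finset.sum_filter, Finset.sum_filter]
    congr 1
    · refine Finset.sum_congr rfl fun e _ => ?_
      change _ = conj (c (G.t e)) * _
      by_cases he : G.t e = v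
      · simp [c, he]
      · simp [c, he]
    · refine Finset.sum_congr rfl fun e _ => ?_
      change _ = conj (c (G.o e)) * _
      by_cases he : G.o e = v
      · simp [c, he]
      · simp [c, he]

open scoped Classical in
omit [Fintype V] in
/-- An element of the graph of the standard Laplacian comes from `H¹(G)`, with derivatives that are
primitives and satisfy the Kirchhoff condition. -/
theorem IsStandardLaplacian.exists_data {G : MetricGraph V E} {f h : G.L2}
    (hf : G.IsStandardLaplacian f h) :
    ∃ (u : G.H1) (a : E → ℂ), G.toL2 u = f ∧
      (∀ e, u.1.2 e = a e • one (G.len e) + volterra (G.len e) (-(h e))) ∧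
      ∀ v, (∑ e with G.t e = v, (a e + total (G.len e) (-(h e)))) -
        (∑ e with G.o e = v, a e) = 0 := by
  obtain ⟨f', hw, hw', ⟨c, hc⟩, a, b, hab, hK⟩ := hf
  have h1 : ∀ e, f e = c (G.o e) • one (G.len e) + volterra (G.len e) (f' e) ∧
      c (G.o e) + total (G.len e) (f' e) = c (G.t e) := fun e => by
    have hℓ := G.len_pos e
    obtain ⟨α, hα⟩ := (hw e).exists_eq hℓ
    have h0 := (hc e).1
    have h1 := (hc e).2
    rw [hα] at h0 h1
    have e0 := h0.unique ⟨le_rfl, hℓ.le⟩ hℓ (hasEdgeValue_smul_one_add_volterra_zero α (f' e))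
    have e1 := h1.unique ⟨hℓ.le, le_rfl⟩ hℓ (hasEdgeValue_smul_one_add_volterra_end α (f' e))
    rw [e0, e1]
    exact ⟨hα, rfl⟩
  have h2 : ∀ e, f' e = a e • one (G.len e) + volterra (G.len e) (-(h e)) ∧
      a e + total (G.len e) (-(h e)) = b e := fun e => by
    have hℓ := G.len_pos e
    obtain ⟨α, hα⟩ := (hw' e).exists_eq hℓ
    have h0 := (hab e).1
    have h1 := (hab e).2
    rw [hα] at h0 h1
    have e0 := h0.unique ⟨le_rfl, hℓ.le⟩ hℓ (hasEdgeValue_smul_one_add_volterra_zero α (-(h e)))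
    have e1 := h1.unique ⟨hℓ.le, le_rfl⟩ hℓ (hasEdgeValue_smul_one_add_volterra_end α (-(h e)))
    rw [e0, e1]
    exact ⟨hα, rfl⟩
  refine ⟨⟨(c, f'), G.mem_H1.2 fun e => (h1 e).2⟩, a, PiLp.ext fun e => (h1 e).1.symm,
    fun e => (h2 e).1, fun v => ?_⟩
  rw [← hK v]
  congr 1
  exact Finset.sum_congr rfl fun e _ => (h2 e).2

/-- After integration by parts the boundary terms, grouped by vertex, are the test value times the
Kirchhoff sum, hence zero. -/
theorem IsStandardLaplacian.exists_mem_eigenspace {G : MetricGraph V E} {f : G.L2}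
    {lam : ℝ} (hf : G.IsStandardLaplacian f ((lam : ℂ) • f)) :
    ∃ u ∈ eigenspace G.toL2 G.derivL2 lam, G.toL2 u = f := by
  classical
  obtain ⟨u, a, rfl, ha, hK⟩ := hf.exists_data
  refine ⟨u, fun v => ?_, rfl⟩
  have h1 := G.inner_derivL2_add_inner_toL2 v (h := -((lam : ℂ) • G.toL2 u)) ha
  have h2 : ∑ e, (conj (v.1.1 (G.t e)) *
      (a e + total (G.len e) ((-((lam : ℂ) • G.toL2 u)) e)) - conj (v.1.1 (G.o e)) * a e) = 0 := by
    rw [Finset.sum_sub_distrib, ← Finset.sum_fiberwise _ G.t,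
      ← Finset.sum_fiberwise _ G.o fun e => conj (v.1.1 (G.o e)) * a e, ← Finset.sum_sub_distrib]
    refine Finset.sum_eq_zero fun w _ => ?_
    have h3 : ∀ b : E → ℂ, ∀ g : E → V, ∑ e with g e = w, conj (v.1.1 (g e)) * b e =
        conj (v.1.1 w) * ∑ e with g e = w, b e := fun b g => by
      rw [Finset.mul_sum]
      refine Finset.sum_congr rfl fun e he => ?_
      rw [(Finset.mem_filter.1 he).2]
    rw [h3, h3, ← mul_sub]
    refine mul_eq_zero_of_right _ ?_
    exact hK w
  rw [h2, inner_neg_right, inner_smul_right] at h1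
  rw [derivL2_apply G u]
  linear_combination h1

/-- The spectral subspaces of the standard Laplacian are those of its quadratic form. -/
theorem spectralSubspace_eq_map (μ : ℝ) :
    G.spectralSubspace μ = (spectralSpace G.toL2 G.derivL2 μ).map (G.toL2 : G.H1 →ₗ[ℂ] G.L2) := by
  apply le_antisymm
  · refine Submodule.span_le.2 ?_
    rintro f ⟨lam, hlam, hf⟩
    obtain ⟨u, hu, rfl⟩ := hf.exists_mem_eigenspace
    exact ⟨u, eigenspace_le_spectralSpace hlam hu, rfl⟩
  · rw [spectralSpace, Submodule.map_iSup, iSup_le_iff]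
    rintro lam _ ⟨u, hu, rfl⟩
    exact Submodule.subset_span ⟨lam, lam.2, G.isStandardLaplacian_of_mem_eigenspace hu⟩

/-- A trace estimate: the constant f(0) on an edge is f minus the primitive of f', so its norm is
controlled; adding the integral of f' bounds the value at the other end. -/
theorem coercive (hG : ∀ v, ∃ e, G.o e = v ∨ G.t e = v) : Coercive G.toL2 G.derivL2 := by
  have ho : ∀ e, ∃ C : ℝ, 0 ≤ C ∧ ∀ u : G.H1,
      ‖u.1.1 (G.o e)‖ ≤ C * (‖G.toL2 u‖ + ‖G.derivL2 u‖) := fun e => by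
    refine ⟨(1 + ‖volterra (G.len e)‖) / ‖one (G.len e)‖, by positivity, fun u => ?_⟩
    rw [div_mul_eq_mul_div, le_div_iff₀ (norm_one_pos (G.len_pos e)), ← norm_smul]
    have h1 : u.1.1 (G.o e) • one (G.len e) = G.toL2 u e - volterra (G.len e) (u.1.2 e) := by
      rw [toL2_apply, add_sub_cancel_right]
    rw [h1]
    have h2 := norm_sub_le (G.toL2 u e) (volterra (G.len e) (u.1.2 e))
    have h3 := (volterra (G.len e)).le_opNorm (u.1.2 e)
    have h4 : ‖G.toL2 u e‖ ≤ ‖G.toL2 u‖ := PiLp.norm_apply_le _ _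
    have h5 : ‖u.1.2 e‖ ≤ ‖G.derivL2 u‖ := PiLp.norm_apply_le _ _
    nlinarith [norm_nonneg (volterra (G.len e)), norm_nonneg (G.toL2 u),
      norm_nonneg (G.derivL2 u), mul_le_mul_of_nonneg_left h5 (norm_nonneg (volterra (G.len e))),
      mul_nonneg (norm_nonneg (volterra (G.len e))) (norm_nonneg (G.toL2 u))]
  have hv : ∀ v, ∃ C : ℝ, 0 ≤ C ∧ ∀ u : G.H1,
      ‖u.1.1 v‖ ≤ C * (‖G.toL2 u‖ + ‖G.derivL2 u‖) := fun v => by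
    obtain ⟨e, rfl | rfl⟩ := hG v
    · exact ho e
    · obtain ⟨C, hC0, hC⟩ := ho e
      refine ⟨C + ‖total (G.len e)‖, by positivity, fun u => ?_⟩
      rw [← G.mem_H1.1 u.2 e]
      have h2 := norm_add_le (u.1.1 (G.o e)) (total (G.len e) (u.1.2 e))
      have h3 := (total (G.len e)).le_opNorm (u.1.2 e)
      have h5 : ‖u.1.2 e‖ ≤ ‖G.derivL2 u‖ := PiLp.norm_apply_le _ _
      nlinarith [hC u, mul_le_mul_of_nonneg_left h5 (norm_nonneg (total (G.len e))),
        mul_nonneg (norm_nonneg (total (G.len e))) (norm_nonneg (G.toL2 u))]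
  choose C hC0 hC using hv
  refine ⟨1 + ∑ v, C v, fun u => ?_⟩
  have hsum : 0 ≤ ∑ v, C v := Finset.sum_nonneg fun v _ => hC0 v
  have hN : 0 ≤ ‖G.toL2 u‖ + ‖G.derivL2 u‖ := by positivity
  change max ‖u.1.1‖ ‖u.1.2‖ ≤ _
  refine max_le ?_ ?_
  · rw [pi_norm_le_iff_of_nonneg (by positivity)]
    intro v
    refine (hC v u).trans (mul_le_mul_of_nonneg_right ?_ hN)
    linarith [Finset.single_le_sum (fun v _ => hC0 v) (Finset.mem_univ v)]
  · change ‖G.derivL2 u‖ ≤ _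
    nlinarith [norm_nonneg (G.toL2 u), mul_nonneg hsum hN]

instance : CompleteSpace G.H1 := G.isClosed_H1.completeSpace_coe

omit [Fintype V] [Fintype E] in
/-- `H¹(G)` is infinite-dimensional, since it contains the functions `x (x - ℓ) p(x)` on an edge, for
every polynomial `p`. -/
theorem exists_injective_H1 (e : E) (k : ℕ) :
    ∃ T : (Fin k → ℂ) →ₗ[ℂ] G.H1, Function.Injective T := by
  open Polynomial in
  set ℓ := G.len e with hℓ
  -- The factor vanishes at both ends of the edge, so the function extends by zero to H¹(G); `g p`
  -- below is its derivative.
  let q : ℂ[X] → ℂ[X] := fun p => X * (X - C (ℓ : ℂ)) * p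
  have hcont : ∀ p : ℂ[X], Continuous fun x : ℝ => (derivative (q p)).eval (x : ℂ) := fun p => by
    fun_prop
  have hder : ∀ (p : ℂ[X]) (x : ℝ), HasDerivAt (fun x : ℝ => (q p).eval (x : ℂ))
      ((derivative (q p)).eval (x : ℂ)) x := fun p x =>
    ((q p).hasDerivAt (x : ℂ)).comp_ofReal
  have hq0 : ∀ p, (q p).eval ((0 : ℝ) : ℂ) = 0 := fun p => by simp [q]
  have hqℓ : ∀ p, (q p).eval (ℓ : ℂ) = 0 := fun p => by simp [q]
  let g : ℂ[X] → L2Interval ℓ := fun p => ofCont ℓ _ (hcont p)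
  have hg0 : ∀ p, total ℓ (g p) = 0 := fun p => by
    rw [total_ofCont (hcont p) (hder p) (G.len_pos e).le, hq0, hqℓ, sub_zero]
  let Φ : ℂ[X] →ₗ[ℂ] G.H1 :=
    { toFun := fun p => ⟨(0, G.single e (g p)), G.mem_H1.2 fun e' => by
        change (0 : ℂ) + total (G.len e') (G.single e (g p) e') = 0
        rcases eq_or_ne e' e with rfl | hne
        · rw [single_apply_same, hg0, add_zero]
        · rw [G.single_apply_ne hne, map_zero, add_zero]⟩
      map_add' := fun p p' => by
        have h1 : g (p + p') = g p + g p' := by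
          simp only [g, ofCont]
          rw [← MemLp.toLp_add]
          congr 1
          ext x
          simp [q, mul_add]
        refine Subtype.ext (Prod.ext (by simp) ?_)
        change G.single e (g (p + p')) = G.single e (g p) + G.single e (g p')
        rw [h1, map_add]
      map_smul' := fun c p => by
        have h1 : g (c • p) = c • g p := by
          simp only [g, ofCont]
          rw [← MemLp.toLp_const_smul]
          congr 1
          ext x
          simp only [q, mul_smul_comm, derivative_smul, eval_smul, Pi.smul_apply]
        refine Subtype.ext (Prod.ext (by simp) ?_)
        change G.single e (g (c • p)) = c • G.single e (g p)
        rw [h1, map_smul] }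
  have hΦ : Function.Injective Φ := by
    rw [← LinearMap.ker_eq_bot, LinearMap.ker_eq_bot']
    intro p hp
    have h1 : g p = 0 := by
      have h2 : G.single e (g p) = 0 := congrArg (fun u : G.H1 => u.1.2) hp
      rw [← G.single_apply_same e (g p), h2]; rfl
    have h3 : q p = 0 := by
      refine Polynomial.eq_zero_of_infinite_isRoot _
        (((Icc_infinite (G.len_pos e)).image (Complex.ofReal_injective.injOn)).mono ?_)
      rintro _ ⟨x, hx, rfl⟩
      have h4 := prim_ofCont (ℓ := ℓ) (hcont p) (hder p) hx.1 hx.2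
      have h5 : prim (g p) x = 0 := by
        rw [h1, ← primL_apply, map_zero]
      rw [hq0, sub_zero] at h4
      exact h4.symm.trans h5
    have h6 : (X * (X - C (ℓ : ℂ)) : ℂ[X]) ≠ 0 :=
      mul_ne_zero X_ne_zero (X_sub_C_ne_zero _)
    exact (mul_eq_zero.1 h3).resolve_left h6
  exact ⟨Φ ∘ₗ (degreeLT ℂ k).subtype ∘ₗ (degreeLTEquiv ℂ k).symm.toLinearMap,
    hΦ.comp (Subtype.val_injective.comp (degreeLTEquiv ℂ k).symm.injective)⟩

theorem rank_spectralSubspace_le_iff (hG : ∀ v, ∃ e, G.o e = v ∨ G.t e = v) {k : ℕ} {μ : ℝ} :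
    (k : Cardinal) ≤ Module.rank ℂ (G.spectralSubspace μ) ↔
      (k : Cardinal) ≤ Module.rank ℂ (spectralSpace G.toL2 G.derivL2 μ) := by
  have hinj : Function.Injective (G.toL2 : G.H1 →ₗ[ℂ] G.L2) := by
    rw [← LinearMap.ker_eq_bot, LinearMap.ker_eq_bot']
    exact fun u hu => G.toL2_eq_zero hG hu
  rw [spectralSubspace_eq_map, Module.le_rank_iff_exists_linearMap,
    Module.le_rank_iff_exists_linearMap]
  let e := Submodule.equivMapOfInjective _ hinj (spectralSpace G.toL2 G.derivL2 μ)
  constructor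
  · rintro ⟨T, hT⟩
    exact ⟨e.symm.toLinearMap ∘ₗ T, e.symm.injective.comp hT⟩
  · rintro ⟨T, hT⟩
    exact ⟨e.toLinearMap ∘ₗ T, e.injective.comp hT⟩

theorem eigenvalue_eq (hG : ∀ v, ∃ e, G.o e = v ∨ G.t e = v) (k : ℕ) : G.eigenvalue k =
    sInf {μ : ℝ | (k : Cardinal) ≤ Module.rank ℂ (spectralSpace G.toL2 G.derivL2 μ)} := by
  simp only [eigenvalue, G.rank_spectralSubspace_le_iff hG]

/-- The min-max principle: the Rayleigh quotient on a `k`-dimensional subspace of `H¹(G)` bounds the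
`k`-th eigenvalue. -/
theorem eigenvalue_le (hG : ∀ v, ∃ e, G.o e = v ∨ G.t e = v) {k : ℕ} (hk : 1 ≤ k) {μ : ℝ}
    (T : (Fin k → ℂ) →ₗ[ℂ] G.H1) (hT : Function.Injective T)
    (h : ∀ x, ‖G.derivL2 (T x)‖ ^ 2 ≤ μ * ‖G.toL2 (T x)‖ ^ 2) : G.eigenvalue k ≤ μ := by
  rw [G.eigenvalue_eq hG]
  exact csInf_le (bddBelow (G.coercive hG) hk)
    (le_rank_spectralSpace G.isCompactOperator_toL2 (G.coercive hG) T hT h)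

/-- There are at least `k` eigenvalues up to the `k`-th one. -/
theorem exists_injective_spectralSpace [Nonempty E] (hG : ∀ v, ∃ e, G.o e = v ∨ G.t e = v) {k : ℕ}
    (hk : 1 ≤ k) : ∃ T : (Fin k → ℂ) →ₗ[ℂ] G.H1, Function.Injective T ∧
      ∀ x, T x ∈ spectralSpace G.toL2 G.derivL2 (G.eigenvalue k) := by
  -- Nonemptiness ensures that `sInf` is a true infimum and not its default value 0.
  have hne : {μ : ℝ | (k : Cardinal) ≤
      Module.rank ℂ (spectralSpace G.toL2 G.derivL2 μ)}.Nonempty := by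
    obtain ⟨T, hT⟩ := G.exists_injective_H1 (Classical.arbitrary E) k
    obtain ⟨μ, hμ, -⟩ := exists_max_rayleigh (J := G.toL2) (D := G.derivL2) hk T fun x hx h0 =>
      hx (hT ((G.toL2_eq_zero hG h0).trans (map_zero T).symm))
    exact ⟨μ, le_rank_spectralSpace G.isCompactOperator_toL2 (G.coercive hG) T hT hμ⟩
  have h1 := sInf_mem G.isCompactOperator_toL2 (G.coercive hG) hne
  rw [← G.eigenvalue_eq hG] at h1
  obtain ⟨T, hT⟩ := Module.le_rank_iff_exists_linearMap.1 h1
  exact ⟨(spectralSpace G.toL2 G.derivL2 (G.eigenvalue k)).subtype ∘ₗ T,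
    Subtype.val_injective.comp hT, fun x => (T x).2⟩

theorem eigenvalue_nonneg [Nonempty E] (hG : ∀ v, ∃ e, G.o e = v ∨ G.t e = v) {k : ℕ}
    (hk : 1 ≤ k) : 0 ≤ G.eigenvalue k := by
  obtain ⟨T, hT, hmem⟩ := G.exists_injective_spectralSpace hG hk
  have : Nonempty (Fin k) := ⟨⟨0, hk⟩⟩
  obtain ⟨x, hx⟩ := exists_ne (0 : Fin k → ℂ)
  by_contra hneg
  refine hx (hT (((G.coercive hG).eq_zero_of_le (not_le.1 hneg)
    (norm_sq_le_of_mem_spectralSpace (hmem x)) ?_).trans (map_zero T).symm))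
  rw [zero_mul]
  positivity

end

end MetricGraph

/-! ### Connected graphs and unique continuation from a boundary vertex. -/

namespace MetricGraph

open L2Interval FormPencil

variable {V E : Type*}

section Connected

variable {G : MetricGraph V E}

theorem IsConnected.exists_incident_of_ne (hG : G.IsConnected) {u v : V} (h : u ≠ v) :
    ∃ e, G.o e = u ∨ G.t e = u := by
  -- Both endpoints are treated together so that the induction passes through symmetry and
  -- transitivity.
  have key : ∀ x y, Relation.EqvGen (fun a b => ∃ e, G.o e = a ∧ G.t e = b) x y → x ≠ y →
      (∃ e, G.o e = x ∨ G.t e = x) ∧ ∃ e, G.o e = y ∨ G.t e = y := by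
    intro x y hxy
    induction hxy with
    | rel x y h =>
      obtain ⟨e, he⟩ := h
      exact fun _ => ⟨⟨e, Or.inl he.1⟩, e, Or.inr he.2⟩
    | refl x => exact fun h => absurd rfl h
    | symm x y _ ih => exact fun h => (ih h.symm).symm
    | trans x y z _ _ ih1 ih2 =>
      intro hxz
      by_cases hxy : x = y
      · subst hxy; exact ih2 hxz
      · by_cases hyz : y = z
        · subst hyz; exact ih1 hxz
        · exact ⟨(ih1 hxy).1, (ih2 hyz).2⟩
  exact (key u v (hG.2 u v) h).1

theorem IsConnected.exists_incident [Nonempty E] (hG : G.IsConnected) (v : V) :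
    ∃ e, G.o e = v ∨ G.t e = v := by
  let e := Classical.arbitrary E
  by_cases h : G.o e = v
  · exact ⟨e, Or.inl h⟩
  · exact hG.exists_incident_of_ne (Ne.symm h)

theorem IsConnected.forall_of_adjacent (hG : G.IsConnected) {p : V → Prop}
    (h : ∀ e, p (G.o e) ↔ p (G.t e)) {v : V} (hv : p v) (w : V) : p w := by
  have key : ∀ x y, Relation.EqvGen (fun a b => ∃ e, G.o e = a ∧ G.t e = b) x y →
      (p x ↔ p y) := by
    intro x y hxy
    induction hxy with
    | rel x y h' =>
      obtain ⟨e, rfl, rfl⟩ := h'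
      exact h e
    | refl x => rfl
    | symm x y _ ih => exact ih.symm
    | trans x y z _ _ ih1 ih2 => exact ih1.trans ih2
  exact (key v w (hG.2 v w)).1 hv

theorem IsConnected.eq_zero_of_derivL2_eq_zero (hG : G.IsConnected) {u : G.H1}
    (hu : G.derivL2 u = 0) {v : V} (hv : u.1.1 v = 0) : u = 0 := by
  have hg : u.1.2 = 0 := hu
  refine Subtype.ext (Prod.ext (funext fun w => ?_) hg)
  refine hG.forall_of_adjacent (p := fun w => u.1.1 w = 0) (fun e => ?_) hv w
  have := G.mem_H1.1 u.2 e
  rw [hg, PiLp.zero_apply, map_zero, add_zero] at this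
  rw [this]

/-- If λ_k ≤ 0, a k-dimensional space consists of functions with zero derivative. As k ≥ 2, a
nonzero one vanishes at a vertex, which connectedness forbids. -/
theorem IsConnected.eigenvalue_pos [Fintype V] [Fintype E] [Nonempty E] (hG : G.IsConnected)
    {k : ℕ} (hk : 2 ≤ k) : 0 < G.eigenvalue k := by
  obtain ⟨T, hT, hmem⟩ := G.exists_injective_spectralSpace hG.exists_incident (one_le_two.trans hk)
  by_contra hneg
  obtain ⟨v⟩ := hG.1
  let P : (Fin k → ℂ) →ₗ[ℂ] ℂ :=
    LinearMap.proj v ∘ₗ LinearMap.fst ℂ (V → ℂ) G.L2 ∘ₗ G.H1.subtype ∘ₗ T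
  have hP : LinearMap.ker P ≠ ⊥ := P.ker_ne_bot_of_finrank_lt (by simpa using lt_of_lt_of_le one_lt_two hk)
  obtain ⟨x, hx, hx0⟩ := (Submodule.ne_bot_iff _).1 hP
  have h1 := norm_sq_le_of_mem_spectralSpace (hmem x)
  have h2 : G.derivL2 (T x) = 0 := by
    have : ‖G.derivL2 (T x)‖ ^ 2 ≤ 0 :=
      h1.trans (mul_nonpos_of_nonpos_of_nonneg (not_lt.1 hneg) (sq_nonneg _))
    simpa using le_antisymm this (sq_nonneg _)
  exact hx0 (hT ((hG.eq_zero_of_derivL2_eq_zero h2 hx).trans (map_zero T).symm))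

end Connected

theorem _root_.Finset.eq_zero_of_card_le_one_of_sum_eq_zero {α M : Type*} [AddCommMonoid M]
    {s : Finset α} {f : α → M} (hs : s.card ≤ 1) (h : ∑ x ∈ s, f x = 0) {x : α} (hx : x ∈ s) :
    f x = 0 := by
  rw [Finset.sum_eq_single_of_mem x hx] at h
  · exact h
  · exact fun y hy hyx => absurd (Finset.card_le_one.1 hs y hy x hx) hyx

open scoped Classical in
/-- Propagation along a connected graph with degrees at most two, from a boundary vertex: if Cauchy
data `(c, a)`, `(c, b)` at the ends of the edges satisfy the Kirchhoff condition and the data at one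
end of an edge vanish only together with those at the other end, then the data vanish on all edges
as soon as `c` vanishes at the boundary vertex. -/
theorem IsConnected.forall_edge_of_kirchhoff [Fintype E] {G : MetricGraph V E}
    (hG : G.IsConnected) (hdeg : ∀ v, G.degree v ≤ 2) {v : V} (hv : G.IsBoundaryVertex v)
    {c : V → ℂ} {a b : E → ℂ} {p : E → Prop} (hcv : c v = 0)
    (hK : ∀ w, (∑ e with G.t e = w, b e) - (∑ e with G.o e = w, a e) = 0)
    (hp : ∀ e, p e → c (G.o e) = 0 ∧ c (G.t e) = 0 ∧ a e = 0 ∧ b e = 0)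
    (hpo : ∀ e, c (G.o e) = 0 → a e = 0 → p e) (hpt : ∀ e, c (G.t e) = 0 → b e = 0 → p e)
    (e : E) : p e := by
  -- `S w` is the set of edge ends at `w`, a loop contributing two, and `d` is the signed
  -- derivative, so Kirchhoff reads ∑ d = 0.
  let S : V → Finset (E ⊕ E) := fun w =>
    (Finset.univ.filter fun e => G.o e = w).disjSum (Finset.univ.filter fun e => G.t e = w)
  let d : E ⊕ E → ℂ := Sum.elim (fun e => -a e) b
  have hcard : ∀ w, (S w).card = G.degree w := fun w => by
    simp only [S, Finset.card_disjSum, degree]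
  have hsum : ∀ w, ∑ x ∈ S w, d x = 0 := fun w => by
    rw [Finset.sum_disjSum]
    simp only [d, Sum.elim_inl, Sum.elim_inr, Finset.sum_neg_distrib]
    rw [neg_add_eq_sub]
    exact hK w
  have hSo : ∀ e, Sum.inl e ∈ S (G.o e) := fun e => by simp [S]
  have hSt : ∀ e, Sum.inr e ∈ S (G.t e) := fun e => by simp [S]
  have hSp : ∀ w, c w = 0 → ∀ x ∈ S w, d x = 0 → p (Sum.elim id id x) := by
    rintro w hw (e | e) hx hd
    · have he : G.o e = w := by simpa [S] using hx
      exact hpo e (he ▸ hw) (by simpa [d] using hd)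
    · have he : G.t e = w := by simpa [S] using hx
      exact hpt e (he ▸ hw) hd
  -- With at most two ends at `w` and one derivative zero, Kirchhoff leaves at most one term, which
  -- must vanish.
  have hstep : ∀ w, c w = 0 → ∀ x ∈ S w, d x = 0 → ∀ y ∈ S w, p (Sum.elim id id y) := by
    intro w hw x hx hdx y hy
    refine hSp w hw y hy ?_
    by_cases hxy : y = x
    · rw [hxy, hdx]
    · refine Finset.eq_zero_of_card_le_one_of_sum_eq_zero (s := (S w).erase x) ?_ ?_
        (Finset.mem_erase.2 ⟨hxy, hy⟩)
      · rw [Finset.card_erase_of_mem hx, hcard]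
        have := hdeg w
        omega
      · have := Finset.add_sum_erase (S w) d hx
        rwa [hdx, zero_add, hsum] at this
  have hall := hG.forall_of_adjacent (p := fun w => ∀ x ∈ S w, p (Sum.elim id id x)) (v := v)
    (fun e => by
      constructor
      · intro h1
        have he := hp e (h1 _ (hSo e))
        exact hstep _ he.2.1 _ (hSt e) he.2.2.2
      · intro h1
        have he := hp e (h1 _ (hSt e))
        exact hstep _ he.1 _ (hSo e) (by simp [d, he.2.2.1]))
    (fun x hx => hSp v hcv x hx (Finset.eq_zero_of_card_le_one_of_sum_eq_zero
      (by rw [hcard]; exact hv.le) (hsum v) hx))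
  exact hall _ _ (hSo e)

/-- On a connected graph with degrees at most two, an eigenfunction for a positive eigenvalue that
vanishes at a boundary vertex is zero. -/
theorem IsConnected.eq_zero_of_boundary_value_eq_zero [Fintype V] [Fintype E] [Nonempty E]
    {G : MetricGraph V E} (hG : G.IsConnected) (hdeg : ∀ v, G.degree v ≤ 2) {v : V}
    (hv : G.IsBoundaryVertex v) {μ : ℝ} (hμ : 0 < μ) {u : G.H1}
    (hu : u ∈ eigenspace G.toL2 G.derivL2 μ) (huv : u.1.1 v = 0) : u = 0 := by
  have hinc := hG.exists_incident
  obtain ⟨u', a, hu', ha, hK⟩ := (G.isStandardLaplacian_of_mem_eigenspace hu).exists_data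
  obtain rfl : u' = u := by
    rw [← sub_eq_zero]
    exact G.toL2_eq_zero hinc (by rw [map_sub, hu', sub_self])
  refine G.toL2_eq_zero hinc (PiLp.ext fun e => ?_)
  have hct := G.mem_H1.1 u'.2
  -- Vanishing on an edge is equivalent to vanishing Cauchy data at either end, by uniqueness for
  -- the initial value problem.
  refine hG.forall_edge_of_kirchhoff (p := fun e => G.toL2 u' e = 0) hdeg hv huv hK
    (fun e he => ?_) (fun e h1 h2 => ?_) (fun e h1 h2 => ?_) e
  · have h0 : -(((μ : ℂ) • G.toL2 u') e) = 0 := by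
      rw [PiLp.smul_apply, he, smul_zero, neg_zero]
    obtain ⟨h1, h2⟩ := eq_zero_of_smul_one_add_volterra_eq_zero (G.len_pos e)
      ((G.toL2_apply u' e).symm.trans he)
    obtain ⟨h4, -⟩ := eq_zero_of_smul_one_add_volterra_eq_zero (G.len_pos e)
      ((ha e).symm.trans h2)
    refine ⟨h1, ?_, h4, ?_⟩
    · rw [← hct e, h1, h2, map_zero, add_zero]
    · rw [h4, h0, map_zero, add_zero]
  · exact eq_zero_of_cauchy_data hμ (G.len_pos e) (G.toL2_apply u' e) (ha e) (Or.inl ⟨h1, h2⟩)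
  · exact eq_zero_of_cauchy_data hμ (G.len_pos e) (G.toL2_apply u' e) (ha e)
      (Or.inr ⟨(hct e).trans h1, h2⟩)

/-! ### Extension by constants to the attached pendant graphs. -/

section Attach

variable {ι : Type*} {W F : ι → Type*} (H : MetricGraph V E) (P : ∀ i, MetricGraph (W i) (F i))
  (r : ∀ i, W i) (a : ι → V)

/-- Vertex values on the glued graph that are constant on every pendant graph. -/
def extendValues (c : V → ℂ) : V ⊕ (Σ i, {w : W i // w ≠ r i}) → ℂ :=
  Sum.elim c fun p => c (a p.1)

theorem extendValues_pendantVertex (c : V → ℂ) (i : ι) (w : W i) :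
    extendValues r a c (pendantVertex r a i w) = c (a i) := by
  unfold pendantVertex
  split_ifs <;> rfl

theorem eq_of_pendantVertex_eq_inl {i : ι} {w : W i} {v : V}
    (h : pendantVertex r a i w = Sum.inl v) : a i = v := by
  unfold pendantVertex at h
  split_ifs at h
  exact Sum.inl_injective h

theorem exists_incident_attach [Nonempty E] (hH : H.IsConnected) (hP : ∀ i, (P i).IsConnected)
    (v : V ⊕ (Σ i, {w : W i // w ≠ r i})) :
    ∃ e, (H.attach P r a).o e = v ∨ (H.attach P r a).t e = v := by
  rcases v with v | ⟨i, w, hw⟩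
  · obtain ⟨e, he | he⟩ := hH.exists_incident v
    · exact ⟨Sum.inl e, Or.inl (congrArg Sum.inl he)⟩
    · exact ⟨Sum.inl e, Or.inr (congrArg Sum.inl he)⟩
  · have hpv : pendantVertex r a i w = Sum.inr ⟨i, w, hw⟩ := by
      unfold pendantVertex
      rw [dif_neg hw]
    obtain ⟨f, hf | hf⟩ := (hP i).exists_incident_of_ne hw
    · exact ⟨Sum.inr ⟨i, f⟩, Or.inl ((congrArg (pendantVertex r a i) hf).trans hpv)⟩
    · exact ⟨Sum.inr ⟨i, f⟩, Or.inr ((congrArg (pendantVertex r a i) hf).trans hpv)⟩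

/-- Edgewise functions on the glued graph that vanish on the pendant graphs. -/
noncomputable def extendL2 (g : H.L2) : (H.attach P r a).L2 :=
  WithLp.toLp 2 fun e => match e with
    | Sum.inl e => g e
    | Sum.inr _ => 0

/-- The extension of functions in `H¹(H)` by constants on the pendant graphs. -/
noncomputable def extend : H.H1 →ₗ[ℂ] (H.attach P r a).H1 where
  toFun u := ⟨(extendValues r a u.1.1, extendL2 H P r a u.1.2), (mem_H1 _).2 fun e => by
    rcases e with e | ⟨i, f⟩
    · exact H.mem_H1.1 u.2 e
    · change extendValues r a u.1.1 (pendantVertex r a i ((P i).o f)) + total ((P i).len f) 0 =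
        extendValues r a u.1.1 (pendantVertex r a i ((P i).t f))
      rw [extendValues_pendantVertex, extendValues_pendantVertex, map_zero, add_zero]⟩
  map_add' u w := by
    refine Subtype.ext (Prod.ext (funext fun v => ?_) (PiLp.ext fun e => ?_))
    · rcases v with v | p <;> rfl
    · rcases e with e | p
      · rfl
      · exact (add_zero _).symm
  map_smul' c u := by
    refine Subtype.ext (Prod.ext (funext fun v => ?_) (PiLp.ext fun e => ?_))
    · rcases v with v | p <;> rfl
    · rcases e with e | p
      · rfl
      · exact (smul_zero (A := L2Interval ((P p.1).len p.2)) c).symm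

theorem extend_injective : Function.Injective (extend H P r a) := by
  intro u w h
  have h1 : extendValues r a u.1.1 = extendValues r a w.1.1 :=
    congrArg (fun u : (H.attach P r a).H1 => u.1.1) h
  have h2 : extendL2 H P r a u.1.2 = extendL2 H P r a w.1.2 :=
    congrArg (fun u : (H.attach P r a).H1 => u.1.2) h
  refine Subtype.ext (Prod.ext (funext fun v => ?_) (PiLp.ext fun e => ?_))
  · exact congrFun h1 (Sum.inl v)
  · exact congrArg (fun g : (H.attach P r a).L2 => g (Sum.inl e)) h2

variable [Fintype E] [Fintype ι] [∀ i, Fintype (F i)]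

theorem norm_sq_derivL2_extend (u : H.H1) :
    ‖(H.attach P r a).derivL2 (extend H P r a u)‖ ^ 2 = ‖H.derivL2 u‖ ^ 2 := by
  rw [PiLp.norm_sq_eq_of_L2, PiLp.norm_sq_eq_of_L2, Fintype.sum_sum_type]
  have h1 : ∀ p : Σ i, F i, ‖(H.attach P r a).derivL2 (extend H P r a u) (Sum.inr p)‖ ^ 2 = 0 :=
    fun p => by
      have : (H.attach P r a).derivL2 (extend H P r a u) (Sum.inr p) = 0 := rfl
      rw [this, norm_zero]; norm_num
  rw [Finset.sum_eq_zero fun p _ => h1 p, add_zero]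
  rfl

/-- The exact gain of mass is recorded: its sign gives the inequality, and its vanishing forces
zeros at the attaching vertices in the strict case. -/
theorem norm_sq_toL2_extend (u : H.H1) :
    ‖(H.attach P r a).toL2 (extend H P r a u)‖ ^ 2 = ‖H.toL2 u‖ ^ 2 +
      ∑ p : Σ i, F i, ‖u.1.1 (a p.1)‖ ^ 2 * ‖one ((P p.1).len p.2)‖ ^ 2 := by
  rw [PiLp.norm_sq_eq_of_L2, PiLp.norm_sq_eq_of_L2, Fintype.sum_sum_type]
  congr 1
  refine Finset.sum_congr rfl fun p _ => ?_
  have : (H.attach P r a).toL2 (extend H P r a u) (Sum.inr p) =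
      u.1.1 (a p.1) • one ((P p.1).len p.2) := by
    rw [toL2_apply]
    change extendValues r a u.1.1 (pendantVertex r a p.1 ((P p.1).o p.2)) • one ((P p.1).len p.2) +
      volterra ((P p.1).len p.2) 0 = _
    rw [extendValues_pendantVertex, map_zero, add_zero]
  rw [this, ← mul_pow, ← norm_smul]
  rfl

open scoped Classical in
/-- If the degree of a vertex increases, then a pendant graph with an edge is attached to it. -/
theorem exists_pendant_edge {v : V} (h : H.degree v < (H.attach P r a).degree (Sum.inl v)) :
    ∃ p : Σ i, F i, a p.1 = v := by
  by_contra hne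
  push Not at hne
  refine h.ne' ?_
  -- Stated for an arbitrary endpoint map to serve initial and terminal vertices alike: no pendant
  -- edge end meets `v`.
  have key : ∀ (g : E → V) (w : ∀ p : Σ i, F i, W p.1),
      (Finset.univ.filter fun e : E ⊕ (Σ i, F i) => Sum.elim (fun e => Sum.inl (g e))
        (fun p => pendantVertex r a p.1 (w p)) e = Sum.inl v).card =
      (Finset.univ.filter fun e => g e = v).card := by
    intro g w
    rw [Finset.card_filter, Finset.card_filter, Fintype.sum_sum_type]
    have h1 : ∀ p : Σ i, F i, pendantVertex r a p.1 (w p) ≠ Sum.inl v := fun p hp =>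
      hne p (eq_of_pendantVertex_eq_inl r a hp)
    simp [h1]
  refine congrArg₂ (· + ·) ?_ ?_
  · convert key H.o fun p => (P p.1).o p.2
    rfl
  · convert key H.t fun p => (P p.1).t p.2
    rfl

end Attach

end MetricGraph

/-! ### The comparison of eigenvalues. -/

open MetricGraph FormPencil L2Interval in
theorem proposition3p1 {V E ι : Type*} {W F : ι → Type*}
    [Fintype V] [Fintype E] [Nonempty E] [Fintype ι] [∀ i, Fintype (W i)] [∀ i, Fintype (F i)]
    (H : MetricGraph V E) (hH : H.IsConnected)
    (P : ∀ i, MetricGraph (W i) (F i)) (hP : ∀ i, (P i).IsConnected)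
    (r : ∀ i, W i) (a : ι → V) :
    (∀ k : ℕ, 1 ≤ k → (H.attach P r a).eigenvalue k ≤ H.eigenvalue k) ∧
    (H.IsPathGraph →
      (∃ v : V, H.IsBoundaryVertex v ∧ (H.attach P r a).IsInteriorVertex (Sum.inl v)) →
      ∀ k : ℕ, 2 ≤ k → (H.attach P r a).eigenvalue k < H.eigenvalue k) := by
  have : Fintype (V ⊕ (Σ i, {w : W i // w ≠ r i})) := Fintype.ofFinite _
  have hHinc := hH.exists_incident
  have hGinc := exists_incident_attach H P r a hH hP
  have hterm : ∀ (u : H.H1) (p : Σ i, F i),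
      0 ≤ ‖u.1.1 (a p.1)‖ ^ 2 * ‖one ((P p.1).len p.2)‖ ^ 2 := fun u p =>
    mul_nonneg (sq_nonneg _) (sq_nonneg _)
  have hnonneg := fun u : H.H1 => Finset.sum_nonneg fun p (_ : p ∈ Finset.univ) => hterm u p
  refine ⟨fun k hk => ?_, fun hpath hv k hk => ?_⟩
  · obtain ⟨T, hT, hmem⟩ := H.exists_injective_spectralSpace hHinc hk
    have hμ0 := H.eigenvalue_nonneg hHinc hk
    refine eigenvalue_le _ hGinc hk (extend H P r a ∘ₗ T) ((extend_injective H P r a).comp hT)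
      fun x => ?_
    rw [LinearMap.comp_apply, norm_sq_derivL2_extend, norm_sq_toL2_extend]
    refine (norm_sq_le_of_mem_spectralSpace (hmem x)).trans ?_
    exact mul_le_mul_of_nonneg_left (by linarith [hnonneg (T x)]) hμ0
  · obtain ⟨v, hvH, hvG⟩ := hv
    obtain ⟨p, hp⟩ := exists_pendant_edge H P r a (v := v) (by
      have h1 : H.degree v = 1 := hvH
      have h2 : 2 ≤ (H.attach P r a).degree (Sum.inl v) := hvG
      omega)
    have hμ := hH.eigenvalue_pos hk
    obtain ⟨T, hT, hmem⟩ := H.exists_injective_spectralSpace hHinc (one_le_two.trans hk)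
    have hT' : Function.Injective (extend H P r a ∘ₗ T) := (extend_injective H P r a).comp hT
    -- The maximum is attained, so it suffices to show that this one value lies strictly below
    -- λ_k(H).
    obtain ⟨μ, hle, x, hx0, hx⟩ := exists_max_rayleigh (J := (H.attach P r a).toL2)
      (D := (H.attach P r a).derivL2) (one_le_two.trans hk) (extend H P r a ∘ₗ T)
      fun x hx h0 => hx (hT' ((toL2_eq_zero _ hGinc h0).trans (map_zero _).symm))
    refine (eigenvalue_le _ hGinc (one_le_two.trans hk) _ hT' hle).trans_lt ?_
    by_contra hge
    rw [not_lt] at hge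
    rw [LinearMap.comp_apply, norm_sq_derivL2_extend, norm_sq_toL2_extend] at hx
    have h1 := norm_sq_le_of_mem_spectralSpace (hmem x)
    set s := ∑ p : Σ i, F i, ‖(T x).1.1 (a p.1)‖ ^ 2 * ‖one ((P p.1).len p.2)‖ ^ 2 with hs
    have hs0 : 0 ≤ s := hnonneg (T x)
    have h2 : H.eigenvalue k * (‖H.toL2 (T x)‖ ^ 2 + s) ≤ ‖H.derivL2 (T x)‖ ^ 2 := by
      rw [hx]
      exact mul_le_mul_of_nonneg_right hge (by positivity)
    -- The quotient of the extension is at least λ_k(H) and that of T x at most λ_k(H); dividing by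
    -- λ_k(H) > 0 leaves no room for a gain.
    have h3 : s = 0 := le_antisymm
      ((add_le_iff_nonpos_right _).1 (le_of_mul_le_mul_left (h2.trans h1) hμ)) hs0
    have h4 : ‖H.derivL2 (T x)‖ ^ 2 = H.eigenvalue k * ‖H.toL2 (T x)‖ ^ 2 := by
      rw [h3, add_zero] at h2
      exact le_antisymm h1 h2
    have h5 : (T x).1.1 v = 0 := by
      have h6 := (Finset.sum_eq_zero_iff_of_nonneg fun p _ => hterm (T x) p).1 h3 p
        (Finset.mem_univ p)
      rw [hp] at h6
      have h7 := norm_one_pos ((P p.1).len_pos p.2)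
      simpa using (mul_eq_zero.1 h6).resolve_right (pow_pos h7 2).ne'
    have h7 : T x = 0 := hH.eq_zero_of_boundary_value_eq_zero
      (fun w => by rcases hpath.2 w with h | h <;> omega) hvH hμ
      (mem_eigenspace_of_norm_sq_eq (H.coercive hHinc) (hmem x) h4) h5
    exact hx0 (hT (h7.trans (map_zero T).symm))
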